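/- Let $R$ be a commutative artinian ring, and call an $R$-algebra that is finitely generated as an $R$-module an artin algebra. For an artin algebra $\Lambda$ let $\Lambda\text{-mod}$ be the category of finitely generated left $\Lambda$-modules, $D^b(\Lambda\text{-mod})$ its bounded derived category, $\operatorname{rad}\Lambda$ the Jacobson radical, $\Omega(M)$ the kernel of a projective cover of $M\in\Lambda\text{-mod}$, $\Omega^0(M)=M$, $\Omega^{n+1}(M)=\Omega(\Omega^n(M))$, and $\operatorname{add}\mathcal U$ the class of direct summands of finite direct sums of objects of $\mathcal U$ (with $\operatorname{add}V=\operatorname{add}\{V\}$). We use the following notions. - $\Lambda$ is *representation-finite* if up to isomorphism it has only finitely many indecomposable finitely generated left modules. - An artin algebra $\Lambda'\supseteq\Lambda$ containing $\Lambda$ as an $R$-subalgebra with the same identity is a *left idealized extension* of $\Lambda$ if $\operatorname{rad}\Lambda$ is a left ideal of $\Lambda'$. - $\Lambda$ is an *$(m,n)$-IT (Igusa–Todorov) algebra* if there is $V\in\Lambda\text{-mod}$ such that for every $M\in\Lambda\text{-mod}$ there is an exact sequence $0\to V_m\to\cdots\to V_1\to V_0\to\Omega^n(M)\to 0$ with all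 $V_i\in\operatorname{add}V$. - For an object $T$ of a triangulated category $\mathcal T$ let $\langle T\rangle_1=\operatorname{add}\{T[i]: i\in\mathbb Z\}$, and let $\langle T\rangle_{n+1}$ consist of the direct summands of objects $X$ for which there is a distinguished triangle $X_1\to X\to X_2\to X_1[1]$ with $X_1\in\langle T\rangle_n$, $X_2\in\langle T\rangle_1$. Then $\operatorname{tri.dim}\mathcal T$ (the Rouquier dimension) is the least $n\ge 0$ with $\mathcal T=\langle T\rangle_{n+1}$ for some $T$, or $\infty$ if there is none. - For $T\in\Lambda\text{-mod}$ let $[T]_1=\operatorname{add}T$, and let $[T]_{n}=\operatorname{add}\{M : \text{there is a short exact sequence } 0\to U_1\to M\to U_2\to 0 \text{ with } U_1\in[T]_1,\ U_2\in[T]_{n-1}\}$ for $n\ge 2$. Then $\operatorname{ext.dim}\Lambda$ is the least $n\ge0$ with $\Lambda\text{-mod}=[T]_{n+1}$ for some $T\in\Lambda\text{-mod}$, or $\infty$ if there is none. **Theorem.** Let $m\ge 1$ and let $\Lambda=\Lambda_0\subseteq\Lambda_1\subseteq\cdots\subseteq\Lambda_m=\Gamma$ be a chain of artin algebras (over $R$)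 such that $\Lambda_{i+1}$ is a left idealized extension of $\Lambda_i$ for $0\le i\le m-1$ and $\Gamma$ is representation-finite. Then 1. $\Lambda$ is an $(m-1,2)$-IT algebra; 2. $\operatorname{tri.dim}D^b(\Lambda\text{-mod})\le 2m+1$ and $\operatorname{ext.dim}\Lambda\le m+1$. -/

import Mathlib

open CategoryTheory CategoryTheory.Limits

universe w v u

/-! ### Additive closures, syzygies, resolutions and extension dimension in an abelian category

These are applied below to the category `FGModuleCat A` of finitely generated left `A`-modules. -/

namespace ArtinAlg

section Abelian

attribute [local instance] Abelian.hasFiniteBiproducts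

variable {C : Type u} [Category.{v} C] [Abelian C]

/-- `add U`: the objects that are direct summands of finite direct sums of objects in `U`.
(In an abelian category a retract is the same thing as a direct summand.) -/
def addClosure (U : ObjectProperty C) : ObjectProperty C := fun X =>
  ∃ (k : ℕ) (F : Fin k → C), (∀ i, U (F i)) ∧ Nonempty (Retract X (⨁ F))

/-- `p : P ⟶ X` is a projective cover: `P` is projective and `p` is an essential epimorphism. -/
structure IsProjectiveCover {P X : C} (p : P ⟶ X) : Prop where
  projective : Projective P
  epi : Epi p
  essential : ∀ {Q : C} (g : Q ⟶ P), Epi (g ≫ p) → Epi g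

/-- `IsSyzygy n X K` says that `K` is (isomorphic to) the `n`-th syzygy `Ω^n(X)`:
`Ω^0(X) = X`, and `Ω^{n+1}(X)` is the kernel of a projective cover of `Ω^n(X)`.
(Projective covers are unique up to isomorphism, so `K` is determined up to isomorphism.) -/
def IsSyzygy : ℕ → C → C → Prop
  | 0, X, K => Nonempty (K ≅ X)
  | n + 1, X, K => ∃ (L P : C) (i : K ⟶ P) (p : P ⟶ L) (h : i ≫ p = 0),
      IsSyzygy n X L ∧ IsProjectiveCover p ∧ (ShortComplex.mk i p h).ShortExact

/-- There is an exact sequence `0 ⟶ V_m ⟶ ⋯ ⟶ V_1 ⟶ V_0 ⟶ Y ⟶ 0` with every `V_i` in `U`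
(an exact sequence of length `m + 1` being the same as a short exact sequence
`0 ⟶ Z ⟶ V_0 ⟶ Y ⟶ 0` spliced with an exact sequence `0 ⟶ V_{m+1} ⟶ ⋯ ⟶ V_1 ⟶ Z ⟶ 0`). -/
def HasResolution (U : ObjectProperty C) : ℕ → C → Prop
  | 0, Y => ∃ V₀ : C, U V₀ ∧ Nonempty (V₀ ≅ Y)
  | m + 1, Y => ∃ (Z V₀ : C) (i : Z ⟶ V₀) (p : V₀ ⟶ Y) (h : i ≫ p = 0),
      U V₀ ∧ (ShortComplex.mk i p h).ShortExact ∧ HasResolution U m Z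

/-- `U₁ • U₂`: the additive closure of the class of all `M` that fit in a short exact sequence
`0 ⟶ U₁ ⟶ M ⟶ U₂ ⟶ 0`. -/
def extProd (U₁ U₂ : ObjectProperty C) : ObjectProperty C :=
  addClosure fun M => ∃ (X Y : C) (i : X ⟶ M) (p : M ⟶ Y) (h : i ≫ p = 0),
    U₁ X ∧ U₂ Y ∧ (ShortComplex.mk i p h).ShortExact

/-- `[U]_n`: `[U]_0 = 0`, `[U]_1 = add U` and `[U]_n = [U]_1 • [U]_{n-1}` for `n ≥ 2`. -/
def extLayer (U : ObjectProperty C) : ℕ → ObjectProperty C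
  | 0 => IsZero
  | 1 => addClosure U
  | n + 2 => extProd (addClosure U) (extLayer U (n + 1))

variable (C) in
/-- The extension dimension of `C`: the least `n` with `C = [T]_{n+1}` for some object `T`
(`⊤` if there is none). -/
noncomputable def extDim : ℕ∞ :=
  ⨅ (n : ℕ) (_ : ∃ T : C, ∀ X : C, extLayer (ObjectProperty.singleton T) (n + 1) X), (n : ℕ∞)

end Abelian

/-! ### Dimension of a triangulated category, bounded derived category -/

section Triangulated

/-- The (Rouquier) dimension of a triangulated category: the least `n` with `𝒯 = ⟨T⟩_{n+1}` for
some object `T` (`⊤` if there is none). Mathlib's `triangEnvelopeIter n` is `⟨-⟩_{n+1}`: it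
starts with the direct summands of finite direct sums of shifts, takes the `(n + 1)`-fold product
`*` of this class with itself, and closes under direct summands. -/
noncomputable def triDim (T : Type u) [Category.{v} T] [HasZeroObject T] [HasShift T ℤ]
    [Preadditive T] [∀ n : ℤ, (shiftFunctor T n).Additive] [Pretriangulated T] : ℕ∞ :=
  ⨅ (n : ℕ) (_ : ∃ X : T, (ObjectProperty.singleton X).triangEnvelopeIter n = ⊤), (n : ℕ∞)

/-- The bounded derived category `D^b(C)`, as the full triangulated subcategory of the bounded
objects in the derived category of `C`. -/
abbrev BoundedDerivedCategory (C : Type u) [Category.{v} C] [Abelian C]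
    [HasDerivedCategory.{w} C] :=
  (DerivedCategory.TStructure.t (C := C)).bounded.FullSubcategory

end Triangulated

/-! ### Rings and artin algebras -/

/-- `A` is representation-finite: up to isomorphism there are only finitely many
indecomposable finitely generated left `A`-modules. -/
def IsRepresentationFinite (A : Type u) [Ring A] : Prop :=
  ∃ (k : ℕ) (F : Fin k → FGModuleCat.{u} A), ∀ M : FGModuleCat.{u} A,
    Nontrivial M → (∀ N N' : Submodule A M, IsCompl N N' → N = ⊥ ∨ N' = ⊥) →
      ∃ i, Nonempty (M ≃ₗ[A] F i)

/-- `A` is an `(m, n)`-Igusa–Todorov algebra: there is a finitely generated module `V` such that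
for every finitely generated module `M` there is an exact sequence
`0 ⟶ V_m ⟶ ⋯ ⟶ V_1 ⟶ V_0 ⟶ Ω^n(M) ⟶ 0` with all `V_i ∈ add V`. -/
def IsIgusaTodorov (A : Type u) [Ring A] [IsNoetherianRing A] (m n : ℕ) : Prop :=
  ∃ V : FGModuleCat.{u} A, ∀ M : FGModuleCat.{u} A, ∃ K : FGModuleCat.{u} A,
    IsSyzygy n M K ∧ HasResolution (addClosure (ObjectProperty.singleton V)) m K

section Algebra

variable {R : Type v} [CommRing R] {E : Type u} [Ring E] [Algebra R E]

/-- For subalgebras `A`, `B` of an algebra, `B` is a left idealized extension of `A`: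
`A ⊆ B` and the Jacobson radical of `A` is a left ideal of `B`. (Subalgebras of `E` share the
identity of `E`, and the radical is an additive subgroup, so only stability under left
multiplication by `B` has to be required.) -/
def IsLeftIdealizedExtension (A B : Subalgebra R E) : Prop :=
  A ≤ B ∧ ∀ b ∈ B, ∀ x ∈ Ring.jacobson A, ∃ y ∈ Ring.jacobson A, (y : E) = b * (x : E)

/-- A subalgebra of an artin algebra is noetherian. -/
instance isNoetherianRing_subalgebra [IsArtinianRing R] [Module.Finite R E]
    (A : Subalgebra R E) : IsNoetherianRing A :=
  isNoetherian_of_tower R (inferInstanceAs (IsNoetherian R (Subalgebra.toSubmodule A)))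

end Algebra

end ArtinAlg

/-!
Let `J = rad A`. If `C` is a left idealized extension of `A`, then multiplication by an element of
`C` maps `J` to `J`. Let `Y` be a *torsionless* `A`-module, that is a submodule of a free module,
with projective cover `P`. The kernel of `P ⟶ Y` lies in `J P`, and it is cut out of the free
module containing `P` by equations in another free module; both are therefore compatible with the
multiplication by `C`. Hence the syzygy of `Y` is the restriction of a `C`-module, which is again
torsionless (`IsLeftIdealizedExtension.exists_torsionless_iso_ker`). Along the chain, the syzygy of
a torsionless `Λ i`-module is thus a torsionless `Λ (i + 1)`-module, and after `m - i` steps one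
arrives at a module over the representation-finite algebra `Λ m`. Restricting the projective covers
to `Λ 0` shows that a torsionless `Λ i`-module has over `Λ 0` a resolution of length `m - i` by
`add V`, where `V` is the direct sum of the algebras `Λ i` with `i < m` and of the indecomposable
`Λ m`-modules (`hasResolution_of_isTorsionless`). All three statements follow from this.

* The first syzygy of a `Λ 0`-module is torsionless, so the second one is a torsionless
  `Λ 1`-module and has a resolution of length `m - 1`.
* A bounded complex `K` is a quotient of a bounded contractible complex of projectives. Up to a
  shift, `K` is thus isomorphic in the derived category to a complex `L` of submodules of
  projective modules. The complexes of cycles and of coboundaries of `L` have zero differential and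
  consist of torsionless modules, which are built from `V` by `m` cones, so `L` is built from `V` by
  `2 m + 1` cones (`triDim_le_of_hasResolution`).
* Every `Λ 0`-module has a resolution of length `m + 1`. An artin algebra has enough finitely
  generated injective modules and an injective cogenerator `E`
  (`exists_injective_mono`, `exists_injective_cogenerator`), and a short exact sequence
  `0 ⟶ Z ⟶ V₀ ⟶ X ⟶ 0` together with an embedding of `Z` in an injective module `I` gives
  `0 ⟶ V₀ ⟶ I ⊞ X ⟶ I / Z ⟶ 0`. The cosyzygy `I / Z` has a resolution which is shorter by one, by
  the cosyzygy of `V` and by `E`, so `X` is built by `m + 1` extensions from one module that depends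
  only on `V` (`extDim_le_of_hasResolution`).
-/

namespace ArtinAlg

/-! ### Additive closures and resolutions -/

section AbelianLemmas

attribute [local instance] Abelian.hasFiniteBiproducts

variable {C : Type u} [Category.{v} C] [Abelian C]

lemma addClosure_of_retract {U : ObjectProperty C} {X Y : C} (r : Retract X Y)
    (hY : addClosure U Y) : addClosure U X := by
  obtain ⟨k, F, hF, ⟨s⟩⟩ := hY
  exact ⟨k, F, hF, ⟨r.trans s⟩⟩

lemma le_addClosure (U : ObjectProperty C) : U ≤ addClosure U := fun X hX =>
  ⟨1, fun _ => X, fun _ => hX, ⟨⟨biproduct.ι (fun _ : Fin 1 => X) 0,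
    biproduct.π (fun _ : Fin 1 => X) 0, by simp⟩⟩⟩

lemma addClosure_of_isZero {U : ObjectProperty C} {X : C} (hX : IsZero X) : addClosure U X :=
  ⟨0, Fin.elim0, fun i => i.elim0, ⟨⟨0, 0, hX.eq_of_src _ _⟩⟩⟩

lemma addClosure_biprod {U : ObjectProperty C} {X Y : C} (hX : addClosure U X)
    (hY : addClosure U Y) : addClosure U (X ⊞ Y) := by
  obtain ⟨k, F, hF, ⟨r⟩⟩ := hX
  obtain ⟨l, G, hG, ⟨s⟩⟩ := hY
  let H : Fin (k + l) → C := Fin.append F G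
  refine ⟨k + l, H, fun i => ?_, ⟨?_⟩⟩
  · refine Fin.addCases (fun i => ?_) (fun i => ?_) i
    · simpa [H] using hF i
    · simpa [H] using hG i
  · have eF : ∀ i, H (Fin.castAdd l i) = F i := fun i => by simp [H]
    have eG : ∀ i, H (Fin.natAdd k i) = G i := fun i => by simp [H]
    let t : Retract ((⨁ F) ⊞ (⨁ G)) (⨁ H) :=
      { i := biprod.desc (biproduct.desc fun i => eqToHom (eF i).symm ≫ biproduct.ι H _)
          (biproduct.desc fun i => eqToHom (eG i).symm ≫ biproduct.ι H _)
        r := biprod.lift (biproduct.lift fun i => biproduct.π H _ ≫ eqToHom (eF i))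
          (biproduct.lift fun i => biproduct.π H _ ≫ eqToHom (eG i))
        retract := by
          have hne : ∀ (i : Fin k) (j : Fin l), Fin.castAdd l i ≠ Fin.natAdd k j := fun i j h => by
            have := congrArg Fin.val h
            simp at this
            omega
          apply biprod.hom_ext' <;> apply biprod.hom_ext <;> apply biproduct.hom_ext' <;>
            intro i <;> apply biproduct.hom_ext <;> intro j
          · by_cases hij : i = j
            · subst hij; simp
            · simp [biproduct.ι_π_ne_assoc _ (fun h => hij (Fin.castAdd_injective _ _ h)),
                biproduct.ι_π_ne _ hij]
          · simp [biproduct.ι_π_ne_assoc _ (hne i j)]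
          · simp [biproduct.ι_π_ne_assoc _ (hne j i).symm]
          · by_cases hij : i = j
            · subst hij; simp
            · simp [biproduct.ι_π_ne_assoc _ (fun h => hij (Fin.natAdd_injective _ _ h)),
                biproduct.ι_π_ne _ hij] }
    exact Retract.trans
      { i := biprod.map r.i s.i, r := biprod.map r.r s.r, retract := by ext <;> simp } t

lemma addClosure_biproduct {U : ObjectProperty C} {k : ℕ} (F : Fin k → C)
    (hF : ∀ i, addClosure U (F i)) : addClosure U (⨁ F) := by
  induction k with
  | zero =>
    refine addClosure_of_isZero ?_
    rw [IsZero.iff_id_eq_zero]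
    exact biproduct.hom_ext' _ _ fun i => i.elim0
  | succ k ih =>
    refine addClosure_of_retract ?_ (addClosure_biprod (hF 0) (ih (fun i => F i.succ)
      (fun i => hF i.succ)))
    exact
      { i := biprod.lift (biproduct.π F 0) (biproduct.lift fun i => biproduct.π F i.succ)
        r := biprod.desc (biproduct.ι F 0) (biproduct.desc fun i => biproduct.ι F i.succ)
        retract := by
          rw [biprod.lift_desc, biproduct.lift_desc, ← biproduct.total, Fin.sum_univ_succ] }

lemma addClosure_le {U W : ObjectProperty C} (h : U ≤ addClosure W) :
    addClosure U ≤ addClosure W := by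
  rintro X ⟨k, F, hF, ⟨r⟩⟩
  exact addClosure_of_retract r (addClosure_biproduct F fun i => h _ (hF i))

lemma addClosure_mono {U W : ObjectProperty C} (h : U ≤ W) : addClosure U ≤ addClosure W :=
  addClosure_le (h.trans (le_addClosure W))

lemma singleton_le_addClosure_of_retract {X Y : C} (r : Retract X Y) :
    ObjectProperty.singleton X ≤ addClosure (ObjectProperty.singleton Y) := by
  intro Z hZ
  obtain rfl : X = Z := by simpa using hZ
  exact addClosure_of_retract r (le_addClosure _ _ (by simp))

lemma addClosure_self (X : C) : addClosure (ObjectProperty.singleton X) X :=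
  le_addClosure _ _ (by simp)

/-- Retraction of a binary biproduct onto its first summand. -/
noncomputable def retractBiprodLeft (X Y : C) : Retract X (X ⊞ Y) :=
  ⟨biprod.inl, biprod.fst, by simp⟩

/-- Retraction of a binary biproduct onto its second summand. -/
noncomputable def retractBiprodRight (X Y : C) : Retract Y (X ⊞ Y) :=
  ⟨biprod.inr, biprod.snd, by simp⟩

lemma addClosure_singleton_le_left (X Y : C) : addClosure (ObjectProperty.singleton X) ≤
    addClosure (ObjectProperty.singleton (X ⊞ Y)) :=
  addClosure_le (singleton_le_addClosure_of_retract (retractBiprodLeft X Y))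

lemma addClosure_singleton_le_right (X Y : C) : addClosure (ObjectProperty.singleton Y) ≤
    addClosure (ObjectProperty.singleton (X ⊞ Y)) :=
  addClosure_le (singleton_le_addClosure_of_retract (retractBiprodRight X Y))

lemma addClosure_functor {D : Type*} [Category* D] [Abelian D] (G : C ⥤ D) [G.Additive]
    {U : ObjectProperty C} {W : ObjectProperty D} (h : ∀ X, U X → addClosure W (G.obj X))
    {X : C} (hX : addClosure U X) : addClosure W (G.obj X) := by
  obtain ⟨k, F, hF, ⟨r⟩⟩ := hX
  refine addClosure_of_retract (r.map G) (addClosure_of_retract ?_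
    (addClosure_biproduct (fun i => G.obj (F i)) fun i => h _ (hF i)))
  exact
    { i := biproduct.lift fun i => G.map (biproduct.π F i)
      r := biproduct.desc fun i => G.map (biproduct.ι F i)
      retract := by
        rw [biproduct.lift_desc]
        simp only [← G.map_comp, ← G.map_sum]
        rw [biproduct.total, G.map_id] }

lemma HasResolution.of_iso {U : ObjectProperty C} {m : ℕ} {X Y : C} (e : X ≅ Y)
    (h : HasResolution U m X) : HasResolution U m Y := by
  cases m with
  | zero =>
    obtain ⟨V, hV, ⟨f⟩⟩ := h
    exact ⟨V, hV, ⟨f ≪≫ e⟩⟩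
  | succ m =>
    obtain ⟨Z, V, i, p, w, hV, hS, hZ⟩ := h
    refine ⟨Z, V, i, p ≫ e.hom, by rw [reassoc_of% w, zero_comp], hV, ?_, hZ⟩
    exact ShortComplex.shortExact_of_iso (S₁ := ShortComplex.mk i p w)
      (ShortComplex.isoMk (Iso.refl _) (Iso.refl _) e (by simp) (by simp)) hS

lemma HasResolution.succ {U : ObjectProperty C} {m : ℕ} {S : ShortComplex C} (hS : S.ShortExact)
    (h₂ : U S.X₂) (h₁ : HasResolution U m S.X₁) : HasResolution U (m + 1) S.X₃ :=
  ⟨S.X₁, S.X₂, S.f, S.g, S.zero, h₂, hS, h₁⟩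

end AbelianLemmas

/-! ### Resolutions bound the extension dimension -/

section ExtensionDimension

attribute [local instance] Abelian.hasFiniteBiproducts

variable {C : Type u} [Category.{v} C] [Abelian C]

lemma extLayer_mono {U W : ObjectProperty C} (h : addClosure U ≤ addClosure W) (n : ℕ) :
    extLayer U n ≤ extLayer W n := by
  induction n with
  | zero => exact le_rfl
  | succ n ih =>
    cases n with
    | zero => exact h
    | succ n =>
      change extProd _ _ ≤ extProd _ _
      refine addClosure_mono ?_
      rintro M ⟨X, Y, i, p, w, hX, hY, hS⟩
      exact ⟨X, Y, i, p, w, h _ hX, ih _ hY, hS⟩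

/-- A form of Schanuel's lemma for injective copresentations: if `S.X₁` is a direct summand of a
power of `T.X₁`, then the inclusion and the projection extend to the middle terms, and the
composite that they induce on `S.X₃` differs from the identity by a map that factors through
`S.X₂`. So the cosyzygy `S.X₃` is a direct summand of the sum of a power of `T.X₃` and `S.X₂`. -/
lemma addClosure_cosyzygy {S T : ShortComplex C} (hS : S.ShortExact) (hT : T.ShortExact)
    [Injective S.X₂] [Injective T.X₂] {W : ObjectProperty C}
    (hS₁ : addClosure (ObjectProperty.singleton T.X₁) S.X₁) (hS₂ : addClosure W S.X₂)
    (hT₃ : addClosure W T.X₃) : addClosure W S.X₃ := by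
  obtain ⟨k, F, hF, ⟨r⟩⟩ := hS₁
  obtain rfl : F = fun _ => T.X₁ := funext fun i => by
    have := hF i
    rw [ObjectProperty.singleton_iff] at this
    exact this.symm
  have := hS.mono_f
  have := hT.mono_f
  have := hS.epi_g
  have := hT.epi_g
  let a (i : Fin k) : S.X₁ ⟶ T.X₁ := r.i ≫ biproduct.π _ i
  let b (i : Fin k) : T.X₁ ⟶ S.X₁ := biproduct.ι (fun _ : Fin k => T.X₁) i ≫ r.r
  have hab : ∑ i, a i ≫ b i = 𝟙 _ := by
    have := r.retract
    rw [← Category.id_comp r.r, ← biproduct.total, Preadditive.sum_comp,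
      Preadditive.comp_sum] at this
    simpa [a, b] using this
  let α (i : Fin k) : S.X₂ ⟶ T.X₂ := Injective.factorThru (a i ≫ T.f) S.f
  let β (i : Fin k) : T.X₂ ⟶ S.X₂ := Injective.factorThru (b i ≫ S.f) T.f
  have hα (i) : S.f ≫ α i = a i ≫ T.f := Injective.comp_factorThru _ _
  have hβ (i) : T.f ≫ β i = b i ≫ S.f := Injective.comp_factorThru _ _
  let α' (i : Fin k) : S.X₃ ⟶ T.X₃ := hS.exact.desc (α i ≫ T.g) (by simp [reassoc_of% (hα i)])
  let β' (i : Fin k) : T.X₃ ⟶ S.X₃ := hT.exact.desc (β i ≫ S.g) (by simp [reassoc_of% (hβ i)])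
  have hα' (i) : S.g ≫ α' i = α i ≫ T.g := hS.exact.g_desc _ _
  have hβ' (i) : T.g ≫ β' i = β i ≫ S.g := hT.exact.g_desc _ _
  let c : S.X₃ ⟶ S.X₂ := hS.exact.desc (𝟙 _ - ∑ i, α i ≫ β i) (by
    simp only [Preadditive.comp_sub, Preadditive.comp_sum, reassoc_of% hα, hβ, Category.comp_id]
    simp only [← Category.assoc]
    rw [← Preadditive.sum_comp, hab, Category.id_comp, sub_self])
  have hc : S.g ≫ c = 𝟙 _ - ∑ i, α i ≫ β i := hS.exact.g_desc _ _
  refine addClosure_of_retract (Y := (⨁ fun _ : Fin k => T.X₃) ⊞ S.X₂) ?_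
    (addClosure_biprod (addClosure_biproduct _ fun _ => hT₃) hS₂)
  exact
    { i := biprod.lift (biproduct.lift α') c
      r := biprod.desc (biproduct.desc β') S.g
      retract := by
        rw [← cancel_epi S.g, biprod.lift_desc, biproduct.lift_desc, Preadditive.comp_add,
          Preadditive.comp_sum, reassoc_of% hc]
        simp only [reassoc_of% hα', hβ', Preadditive.sub_comp, Preadditive.sum_comp,
          Category.assoc, Category.id_comp, Category.comp_id]
        abel }

/-- The cokernels of a monomorphism between short exact sequences form a short exact sequence. -/
lemma exists_shortExact_cokernel {S₁ S₂ : ShortComplex C} (h₁ : S₁.ShortExact)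
    (h₂ : S₂.ShortExact) (v : S₁ ⟶ S₂) [Mono v.τ₁] [Mono v.τ₂] [Mono v.τ₃] :
    ∃ (S₃ : ShortComplex C) (q : S₂ ⟶ S₃) (z₁ : v.τ₁ ≫ q.τ₁ = 0) (z₂ : v.τ₂ ≫ q.τ₂ = 0)
      (z₃ : v.τ₃ ≫ q.τ₃ = 0), S₃.ShortExact ∧ (ShortComplex.mk _ _ z₁).ShortExact ∧
      (ShortComplex.mk _ _ z₂).ShortExact ∧ (ShortComplex.mk _ _ z₃).ShortExact := by
  have := h₁.epi_g
  have := h₂.epi_g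
  have := h₂.mono_f
  let D : ShortComplex.SnakeInput C :=
    { L₀ := kernel v
      L₁ := S₁
      L₂ := S₂
      L₃ := cokernel v
      v₀₁ := kernel.ι v
      v₁₂ := v
      v₂₃ := cokernel.π v
      h₀ := kernelIsKernel v
      h₃ := cokernelIsCokernel v
      L₁_exact := h₁.exact
      epi_L₁_g := h₁.epi_g
      L₂_exact := h₂.exact
      mono_L₂_f := h₂.mono_f }
  have : Epi D.L₂.g := h₂.epi_g
  have hz : IsZero D.L₀.X₃ := by
    rw [IsZero.iff_id_eq_zero]
    have : Mono v.τ₃ := inferInstance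
    have h0 : D.v₀₁.τ₃ = 0 := by
      rw [← cancel_mono v.τ₃, zero_comp]
      exact D.w₀₂_τ₃
    exact Fork.IsLimit.hom_ext D.h₀τ₃ (by simpa using h0)
  refine ⟨D.L₃, D.v₂₃, D.w₁₃_τ₁, D.w₁₃_τ₂, D.w₁₃_τ₃, ?_, ?_, ?_, ?_⟩
  · have hm : Mono D.L₃.f := D.L₂'_exact.mono_g (hz.eq_of_src _ _)
    have he : Epi D.L₃.g := D.epi_L₃_g
    exact ⟨D.L₃_exact⟩
  · have : Mono D.v₁₂.τ₁ := inferInstanceAs (Mono v.τ₁)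
    have he := Cofork.IsColimit.epi D.h₃τ₁
    exact { exact := ShortComplex.exact_of_g_is_cokernel _ D.h₃τ₁, mono_f := this, epi_g := he }
  · have : Mono D.v₁₂.τ₂ := inferInstanceAs (Mono v.τ₂)
    have he := Cofork.IsColimit.epi D.h₃τ₂
    exact { exact := ShortComplex.exact_of_g_is_cokernel _ D.h₃τ₂, mono_f := this, epi_g := he }
  · have : Mono D.v₁₂.τ₃ := inferInstanceAs (Mono v.τ₃)
    have he := Cofork.IsColimit.epi D.h₃τ₃
    exact { exact := ShortComplex.exact_of_g_is_cokernel _ D.h₃τ₃, mono_f := this, epi_g := he }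

/-- A resolution by objects of `add V` with `V = T.X₁` induces a resolution of the same length of
any cosyzygy, by objects of `add (ΣV ⊕ E)` where `ΣV = T.X₃` is a cosyzygy of `V`. -/
lemma HasResolution.cosyzygy {T : ShortComplex C} (hT : T.ShortExact) [Injective T.X₂]
    {E : C} [Injective E] (hE : ∀ X : C, ∃ (k : ℕ) (f : X ⟶ ⨁ fun _ : Fin k => E), Mono f)
    {n : ℕ} {S : ShortComplex C} (hS : S.ShortExact) [Injective S.X₂]
    (hS₂ : addClosure (ObjectProperty.singleton (T.X₃ ⊞ E)) S.X₂)
    (h : HasResolution (addClosure (ObjectProperty.singleton T.X₁)) n S.X₁) :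
    HasResolution (addClosure (ObjectProperty.singleton (T.X₃ ⊞ E))) n S.X₃ := by
  have hT₃ : addClosure (ObjectProperty.singleton (T.X₃ ⊞ E)) T.X₃ :=
    addClosure_singleton_le_left _ _ _ (addClosure_self _)
  have hE' : addClosure (ObjectProperty.singleton (T.X₃ ⊞ E)) E :=
    addClosure_singleton_le_right _ _ _ (addClosure_self _)
  induction n generalizing S with
  | zero =>
    obtain ⟨V₀, hV₀, ⟨e⟩⟩ := h
    exact ⟨_, addClosure_cosyzygy hS hT (addClosure_of_retract e.symm.retract hV₀) hS₂ hT₃,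
      ⟨Iso.refl _⟩⟩
  | succ n ih =>
    obtain ⟨Z, U, i, p, w, hU, hR, hZ⟩ := h
    obtain ⟨k, f, hf⟩ := hE U
    have := hS.mono_f
    have := hR.mono_f
    have := hR.epi_g
    let J : C := ⨁ fun _ : Fin k => E
    have hJ : addClosure (ObjectProperty.singleton (T.X₃ ⊞ E)) J :=
      addClosure_biproduct _ fun _ => hE'
    let R : ShortComplex C := ShortComplex.mk (biprod.inl : J ⟶ J ⊞ S.X₂) biprod.snd (by simp)
    have hR' : R.ShortExact :=
      (ShortComplex.Splitting.ofHasBinaryBiproduct J S.X₂).shortExact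
    -- a horseshoe: `v` embeds the first step of the resolution in a split sequence of injectives
    let v : ShortComplex.mk i p w ⟶ R :=
      { τ₁ := i ≫ f
        τ₂ := biprod.lift f (p ≫ S.f)
        τ₃ := S.f
        comm₁₂ := by
          apply biprod.hom_ext <;> simp [R, reassoc_of% w]
        comm₂₃ := by simp [R] }
    have : Mono i := hR.mono_f
    have : Mono v.τ₁ := mono_comp i f
    have : Mono v.τ₂ := mono_of_mono_fac (biprod.lift_fst f (p ≫ S.f))
    have : Mono v.τ₃ := hS.mono_f
    obtain ⟨S₃, q, z₁, z₂, z₃, hS₃, h₁, h₂, h₃⟩ := exists_shortExact_cokernel hR hR' v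
    have : Injective J := inferInstanceAs (Injective (⨁ fun _ : Fin k => E))
    have H₁ := @ih (ShortComplex.mk _ _ z₁) h₁ ‹Injective J› hJ hZ
    have H₂ := @addClosure_cosyzygy _ _ _ (ShortComplex.mk _ _ z₂) T h₂ hT
      (inferInstanceAs (Injective (J ⊞ S.X₂))) _ _ hU (addClosure_biprod hJ hS₂) hT₃
    exact (HasResolution.succ hS₃ H₂ H₁).of_iso
      (IsColimit.coconePointUniqueUpToIso h₃.gIsCokernel hS.gIsCokernel)

/-- If `0 ⟶ Z ⟶ V ⟶ X ⟶ 0` and `0 ⟶ Z ⟶ J ⟶ Z' ⟶ 0` are exact with `J` injective, then so is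
`0 ⟶ V ⟶ J ⊞ X ⟶ Z' ⟶ 0` (the pushout of the first sequence along `Z ⟶ J` splits). -/
lemma exists_shortExact_biprod {S T : ShortComplex C} (hS : S.ShortExact) (hT : T.ShortExact)
    (e : S.X₁ ≅ T.X₁) [Injective T.X₂] :
    ∃ (i : S.X₂ ⟶ T.X₂ ⊞ S.X₃) (p : T.X₂ ⊞ S.X₃ ⟶ T.X₃) (w : i ≫ p = 0),
      (ShortComplex.mk i p w).ShortExact := by
  have := hS.mono_f
  have := hT.mono_f
  have := hS.epi_g
  have := hT.epi_g
  let f : S.X₂ ⟶ T.X₂ := Injective.factorThru (e.hom ≫ T.f) S.f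
  have hf : S.f ≫ f = e.hom ≫ T.f := Injective.comp_factorThru _ _
  let g : S.X₃ ⟶ T.X₃ := hS.exact.desc (f ≫ T.g) (by simp [reassoc_of% hf])
  have hg : S.g ≫ g = f ≫ T.g := hS.exact.g_desc _ _
  have w : biprod.lift f S.g ≫ biprod.desc T.g (-g) = 0 := by simp [hg]
  refine ⟨biprod.lift f S.g, biprod.desc T.g (-g), w, ?_⟩
  have h1 : Mono (biprod.lift f S.g) := by
    refine Preadditive.mono_of_cancel_zero _ fun {A} x hx => ?_
    have h1 : x ≫ f = 0 := by simpa using hx =≫ biprod.fst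
    have h2 : x ≫ S.g = 0 := by simpa using hx =≫ biprod.snd
    have h3 : hS.exact.lift x h2 ≫ S.f = x := hS.exact.lift_f _ _
    rw [← h3, Category.assoc, hf] at h1
    have h4 : hS.exact.lift x h2 = 0 := by
      rw [← cancel_mono (e.hom ≫ T.f), h1, zero_comp]
    rw [← h3, h4, zero_comp]
  have h2 : Epi (biprod.desc T.g (-g)) := epi_of_epi_fac (biprod.inl_desc T.g (-g))
  refine ⟨?_⟩
  rw [ShortComplex.exact_iff_exact_up_to_refinements]
  intro A x hx
  dsimp at x hx
  obtain ⟨A₁, π₁, hπ₁, y, hy⟩ := surjective_up_to_refinements_of_epi S.g (x ≫ biprod.snd)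
  have hx' : x ≫ biprod.fst ≫ T.g = x ≫ biprod.snd ≫ g := by
    have : x ≫ (biprod.fst ≫ T.g - biprod.snd ≫ g) = 0 := by
      rw [← hx]
      congr 1
      apply biprod.hom_ext' <;> simp
    rwa [Preadditive.comp_sub, sub_eq_zero] at this
  have h0 : (π₁ ≫ x ≫ biprod.fst - y ≫ f) ≫ T.g = 0 := by
    rw [Preadditive.sub_comp, Category.assoc, Category.assoc, Category.assoc, hx', ← hg,
      ← reassoc_of% hy, sub_self]
  let z := hT.exact.lift _ h0
  have hz : z ≫ T.f = π₁ ≫ x ≫ biprod.fst - y ≫ f := hT.exact.lift_f _ _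
  refine ⟨A₁, π₁, hπ₁, y + z ≫ e.inv ≫ S.f, ?_⟩
  dsimp
  apply biprod.hom_ext
  · simp [hf, hz]
  · simp [hy]

/-- An object with a resolution of length `n` by `add V` is built by `n` extensions from a fixed
object that only depends on `V` and `n`: up to an injective summand it is an extension of a
cosyzygy of `Z` by `V₀`, where `0 ⟶ Z ⟶ V₀ ⟶ X ⟶ 0` is the first step of the resolution. -/
theorem exists_extLayer_of_hasResolution [EnoughInjectives C] {E : C} [Injective E]
    (hE : ∀ X : C, ∃ (k : ℕ) (f : X ⟶ ⨁ fun _ : Fin k => E), Mono f) (n : ℕ) (V : C) :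
    ∃ T : C, ∀ X : C, HasResolution (addClosure (ObjectProperty.singleton V)) n X →
      extLayer (ObjectProperty.singleton T) (n + 1) X := by
  induction n generalizing V with
  | zero =>
    refine ⟨V, ?_⟩
    rintro X ⟨V₀, hV₀, ⟨e⟩⟩
    exact addClosure_of_retract e.symm.retract hV₀
  | succ n ih =>
    let R : ShortComplex C := ShortComplex.mk (Injective.ι V) (cokernel.π (Injective.ι V)) (by simp)
    have hR : R.ShortExact := ⟨ShortComplex.exact_cokernel _⟩
    have : Injective R.X₂ := inferInstanceAs (Injective (Injective.under V))
    obtain ⟨T, hT⟩ := ih (R.X₃ ⊞ E)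
    refine ⟨V ⊞ T, ?_⟩
    rintro X ⟨Z, V₀, i, p, w, hV₀, hS, hZ⟩
    obtain ⟨k, f, hf⟩ := hE Z
    let Q : ShortComplex C := ShortComplex.mk f (cokernel.π f) (by simp)
    have hQ : Q.ShortExact := ⟨ShortComplex.exact_cokernel _⟩
    have : Injective Q.X₂ := inferInstanceAs (Injective (⨁ fun _ : Fin k => E))
    have hQ₃ : HasResolution _ n Q.X₃ := HasResolution.cosyzygy hR hE hQ
      (addClosure_biproduct _ fun _ => addClosure_singleton_le_right _ _ _ (addClosure_self _)) hZ
    obtain ⟨i', p', w', hS'⟩ := exists_shortExact_biprod hS hQ (Iso.refl _)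
    change extProd _ _ X
    refine addClosure_of_retract (retractBiprodRight Q.X₂ X) (le_addClosure _ _ ?_)
    exact ⟨_, _, i', p', w', addClosure_singleton_le_left _ _ _ hV₀,
      extLayer_mono (addClosure_singleton_le_right _ _) _ _ (hT _ hQ₃), hS'⟩

/-- If all objects have resolutions of length `n` by `add V`, then the extension dimension is at
most `n`, provided that there are enough injectives and that the powers of one injective object
contain all objects. -/
theorem extDim_le_of_hasResolution [EnoughInjectives C] {E : C} [Injective E]
    (hE : ∀ X : C, ∃ (k : ℕ) (f : X ⟶ ⨁ fun _ : Fin k => E), Mono f) {n : ℕ} {V : C}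
    (hV : ∀ X : C, HasResolution (addClosure (ObjectProperty.singleton V)) n X) :
    extDim C ≤ n := by
  obtain ⟨T, hT⟩ := exists_extLayer_of_hasResolution hE n V
  exact iInf₂_le n ⟨T, fun X => hT X (hV X)⟩

end ExtensionDimension

/-! ### Layers of a triangulated category -/

section TriangulatedDimension

open Pretriangulated

lemma retractClosure_isClosedUnderLimitsOfShape_discrete {D : Type*} [Category* D]
    [HasFiniteProducts D] (P : ObjectProperty D) (J : Type) [Finite J]
    [P.IsClosedUnderLimitsOfShape (Discrete J)] :
    P.retractClosure.IsClosedUnderLimitsOfShape (Discrete J) where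
  limitsOfShape_le := by
    rintro X ⟨p⟩
    choose Y hY r using fun j : J => p.prop_diag_obj ⟨j⟩
    refine ⟨∏ᶜ Y, P.prop_pi Y hY, ⟨?_⟩⟩
    exact
      { i := Pi.lift fun j => p.π.app ⟨j⟩ ≫ (r j).some.i
        r := p.isLimit.lift (Cone.mk _ (Discrete.natTrans fun ⟨j⟩ => Pi.π Y j ≫ (r j).some.r))
        retract := p.isLimit.hom_ext fun ⟨j⟩ => by
          rw [Category.assoc, p.isLimit.fac]
          simp }

variable {T : Type*} [Category* T] [HasZeroObject T] [HasShift T ℤ] [Preadditive T]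
  [∀ n : ℤ, (shiftFunctor T n).Additive] [Pretriangulated T]

lemma extensionProduct_isClosedUnderFiniteProducts (P Q : ObjectProperty T)
    [P.IsClosedUnderFiniteProducts] [Q.IsClosedUnderFiniteProducts] :
    (P.extensionProduct Q).IsClosedUnderFiniteProducts where
  isClosedUnderLimitsOfShape J _ := by
    refine ⟨?_⟩
    rintro X ⟨p⟩
    choose Y Z f g h hT hY hZ using fun j : J => p.prop_diag_obj ⟨j⟩
    have := productTriangle_distinguished (fun j => Triangle.mk (f j) (g j) (h j)) hT
    have hX : P.extensionProduct Q (∏ᶜ fun j => p.diag.obj ⟨j⟩) :=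
      ⟨_, _, _, _, _, this, P.prop_pi _ hY, Q.prop_pi _ hZ⟩
    refine ObjectProperty.prop_of_iso _ ?_ hX
    exact IsLimit.conePointsIsoOfNatIso (limit.isLimit _) p.isLimit
      (Discrete.natIso fun _ => Iso.refl _)

instance (P : ObjectProperty T) [P.Nonempty] :
    (P.binaryProductsClosure.retractClosure).IsClosedUnderFiniteProducts := by
  have : P.binaryProductsClosure.retractClosure.IsClosedUnderBinaryProducts := by
      refine ⟨?_⟩
      rintro X ⟨p⟩
      obtain ⟨Y, hY, ⟨r⟩⟩ := p.prop_diag_obj ⟨.left⟩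
      obtain ⟨Z, hZ, ⟨s⟩⟩ := p.prop_diag_obj ⟨.right⟩
      refine ⟨Y ⨯ Z, ObjectProperty.prop_prod _ _ _ hY hZ, ⟨?_⟩⟩
      exact
        { i := prod.lift (p.π.app ⟨.left⟩ ≫ r.i) (p.π.app ⟨.right⟩ ≫ s.i)
          r := p.isLimit.lift (Cone.mk _ (Discrete.natTrans fun j => match j with
            | ⟨.left⟩ => prod.fst ≫ r.r
            | ⟨.right⟩ => prod.snd ≫ s.r))
          retract := p.isLimit.hom_ext fun j => by
            rw [Category.assoc, p.isLimit.fac]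
            rcases j with ⟨_ | _⟩
            · exact (prod.lift_fst_assoc _ _ _).trans (by simp)
            · exact (prod.lift_snd_assoc _ _ _).trans (by simp) }
  have : P.binaryProductsClosure.Nonempty := .mono (P.le_limitsClosure _)
  have : P.binaryProductsClosure.retractClosure.IsClosedUnderLimitsOfShape
      (Discrete.{0} PEmpty) := by
      refine ⟨?_⟩
      rintro X ⟨p⟩
      have hX : IsZero X := by
        rw [IsZero.iff_id_eq_zero]
        exact p.isLimit.hom_ext fun ⟨j⟩ => j.elim
      refine ⟨_, P.binaryProductsClosure.prop_arbitrary, ⟨hX.retract _⟩⟩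
  exact .mk'

instance isClosedUnderFiniteProducts_triangEnvelopeIter (P : ObjectProperty T) [P.Nonempty]
    (n : ℕ) : (P.triangEnvelopeIter n).IsClosedUnderFiniteProducts := by
  induction n with
  | zero =>
    rw [ObjectProperty.triangEnvelopeIter_zero]
    infer_instance
  | succ n ih =>
    rw [ObjectProperty.triangEnvelopeIter_succ]
    have := extensionProduct_isClosedUnderFiniteProducts
      (P.shiftClosure ℤ).binaryProductsClosure.retractClosure (P.triangEnvelopeIter n)
    exact ⟨fun J _ => retractClosure_isClosedUnderLimitsOfShape_discrete _ J⟩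

/-- The number of cones adds up, with one more for the triangle itself. -/
lemma triangEnvelopeIter_of_distinguished [IsTriangulated T] (P : ObjectProperty T) {a b : ℕ}
    {X Y Z : T} {f : X ⟶ Y} {g : Y ⟶ Z} {h : Z ⟶ X⟦(1 : ℤ)⟧}
    (hT : Triangle.mk f g h ∈ distTriang T) (hX : P.triangEnvelopeIter a X)
    (hZ : P.triangEnvelopeIter b Z) : P.triangEnvelopeIter (a + (b + 1)) Y := by
  rw [ObjectProperty.triangEnvelopeIter_add' P rfl]
  exact ObjectProperty.le_retractClosure _ _ ⟨_, _, _, _, _, hT, hX, hZ⟩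

/-- A distinguished triangle with vertices in a triangulated subcategory is distinguished in the
subcategory. -/
lemma exists_distinguished_fullSubcategory {P : ObjectProperty T} [P.IsTriangulated]
    {X Y Z : P.FullSubcategory} (f : X ⟶ Y) (g : Y ⟶ Z) (h : Z.obj ⟶ X.obj⟦(1 : ℤ)⟧)
    (hT : Triangle.mk f.hom g.hom h ∈ distTriang T) :
    ∃ h' : Z ⟶ X⟦(1 : ℤ)⟧, Triangle.mk f g h' ∈ distTriang P.FullSubcategory := by
  refine ⟨P.fullyFaithfulι.preimage (h ≫ (P.ι.commShiftIso (1 : ℤ)).inv.app X), ?_⟩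
  refine isomorphic_distinguished _ hT _
    (Triangle.isoMk _ _ (Iso.refl X.obj) (Iso.refl Y.obj) (Iso.refl Z.obj)
      ((Category.comp_id _).trans (Category.id_comp _).symm)
      ((Category.comp_id _).trans (Category.id_comp _).symm) ?_)
  change ((h ≫ (P.ι.commShiftIso (1 : ℤ)).inv.app X) ≫ (P.ι.commShiftIso (1 : ℤ)).hom.app X) ≫
    (shiftFunctor T (1 : ℤ)).map (𝟙 X.obj) = 𝟙 Z.obj ≫ h
  exact ((congrArg (fun t => _ ≫ t) (CategoryTheory.Functor.map_id _ _)).trans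
    (Category.comp_id _)).trans ((Category.assoc _ _ _).trans
      ((congrArg (fun t => h ≫ t) (Iso.inv_hom_id_app (P.ι.commShiftIso (1 : ℤ)) X)).trans
        ((Category.comp_id _).trans (Category.id_comp _).symm)))

end TriangulatedDimension

/-! ### Modules and complexes in the bounded derived category -/

section BoundedDerived

open Pretriangulated

attribute [local instance] Abelian.hasFiniteBiproducts

variable {C : Type u} [Category.{v} C] [Abelian C] [HasDerivedCategory.{w} C]

open DerivedCategory

lemma bounded_singleFunctor (X : C) (i : ℤ) :
    (TStructure.t (C := C)).bounded ((singleFunctor C i).obj X) :=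
  ⟨⟨i, inferInstance⟩, ⟨i, inferInstance⟩⟩

/-- The complex `K` vanishes outside the degrees `[a, b]`. -/
def IsSupported (K : CochainComplex C ℤ) (a b : ℤ) : Prop :=
  ∀ i, ¬ (a ≤ i ∧ i ≤ b) → IsZero (K.X i)

omit [HasDerivedCategory.{w} C] in
lemma isSupported_of_mono {K L : CochainComplex C ℤ} (f : K ⟶ L) [∀ i, Mono (f.f i)] {a b : ℤ}
    (h : IsSupported L a b) : IsSupported K a b := fun i hi => (h i hi).of_mono (f.f i)

lemma IsSupported.bounded {K : CochainComplex C ℤ} {a b : ℤ} (h : IsSupported K a b) :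
    (TStructure.t (C := C)).bounded (Q.obj K) := by
  have h1 : K.IsStrictlyGE a := by
    rw [CochainComplex.isStrictlyGE_iff]
    exact fun i hi => h i (by lia)
  have h2 : K.IsStrictlyLE b := by
    rw [CochainComplex.isStrictlyLE_iff]
    exact fun i hi => h i (by lia)
  exact ⟨⟨a, inferInstance⟩, ⟨b, inferInstance⟩⟩

/-- The functor sending an object of `C` to the bounded derived category, in degree `0`. -/
noncomputable abbrev boundedSingleFunctor : C ⥤ BoundedDerivedCategory C :=
  (TStructure.t (C := C)).bounded.lift (singleFunctor C 0) fun X => bounded_singleFunctor X 0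

/-- The object `X`, placed in degree `0`, as an object of the bounded derived category. -/
noncomputable abbrev boundedSingle (X : C) : BoundedDerivedCategory C :=
  boundedSingleFunctor.obj X

/-- The object of the bounded derived category given by a bounded complex. -/
noncomputable abbrev boundedQ {K : CochainComplex C ℤ} {a b : ℤ} (h : IsSupported K a b) :
    BoundedDerivedCategory C :=
  ⟨Q.obj K, h.bounded⟩

lemma exists_distinguished_boundedQ {S : ShortComplex (CochainComplex C ℤ)} (hS : S.ShortExact)
    {a b : ℤ} (h₁ : IsSupported S.X₁ a b) (h₂ : IsSupported S.X₂ a b)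
    (h₃ : IsSupported S.X₃ a b) :
    ∃ (f : boundedQ h₁ ⟶ boundedQ h₂) (g : boundedQ h₂ ⟶ boundedQ h₃)
      (h : boundedQ h₃ ⟶ (boundedQ h₁)⟦(1 : ℤ)⟧),
      Triangle.mk f g h ∈ distTriang (BoundedDerivedCategory C) := by
  obtain ⟨h, hh⟩ := exists_distinguished_fullSubcategory (P := (TStructure.t (C := C)).bounded)
    (X := boundedQ h₁) (Y := boundedQ h₂) (Z := boundedQ h₃)
    (ObjectProperty.homMk (Q.map S.f)) (ObjectProperty.homMk (Q.map S.g))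
    (triangleOfSESδ hS) (triangleOfSES_distinguished hS)
  exact ⟨_, _, h, hh⟩

lemma exists_distinguished_boundedSingle {S : ShortComplex C} (hS : S.ShortExact) :
    ∃ (f : boundedSingle S.X₁ ⟶ boundedSingle S.X₂)
      (g : boundedSingle S.X₂ ⟶ boundedSingle S.X₃)
      (h : boundedSingle S.X₃ ⟶ (boundedSingle S.X₁)⟦(1 : ℤ)⟧),
      Triangle.mk f g h ∈ distTriang (BoundedDerivedCategory C) := by
  obtain ⟨h, hh⟩ := exists_distinguished_fullSubcategory (P := (TStructure.t (C := C)).bounded)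
    (X := boundedSingle S.X₁) (Y := boundedSingle S.X₂) (Z := boundedSingle S.X₃)
    (ObjectProperty.homMk ((singleFunctor C 0).map S.f))
    (ObjectProperty.homMk ((singleFunctor C 0).map S.g))
    hS.singleδ hS.singleTriangle_distinguished
  exact ⟨_, _, h, hh⟩

/-- A module with a resolution of length `m` by `add V` is built by `m` cones from `V`. -/
lemma triangEnvelopeIter_of_hasResolution {V : C} {m : ℕ} {X : C}
    (h : HasResolution (addClosure (ObjectProperty.singleton V)) m X) :
    (ObjectProperty.singleton (boundedSingle V)).triangEnvelopeIter m (boundedSingle X) := by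
  have hadd : ∀ X : C, addClosure (ObjectProperty.singleton V) X →
      (ObjectProperty.singleton (boundedSingle V)).triangEnvelopeIter 0
        (boundedSingle X) := by
    rintro X ⟨k, F, hF, ⟨r⟩⟩
    obtain rfl : F = fun _ => V := funext fun i => by
      have := hF i
      rw [ObjectProperty.singleton_iff] at this
      exact this.symm
    have h0 : (ObjectProperty.singleton (boundedSingle V)).triangEnvelopeIter 0
        (∏ᶜ fun _ : Fin k => boundedSingle V) :=
      ObjectProperty.prop_pi _ _ fun _ => ObjectProperty.le_triangEnvelopeIter _ _ _ (by simp)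
    refine ObjectProperty.prop_of_retract _ ?_ h0
    exact
      { i := Pi.lift fun i => boundedSingleFunctor.map (r.i ≫ biproduct.π _ i)
        r := ∑ i, Pi.π (fun _ : Fin k => boundedSingle V) i ≫
          boundedSingleFunctor.map (biproduct.ι (fun _ : Fin k => V) i ≫ r.r)
        retract := by
          rw [Preadditive.comp_sum]
          simp only [Pi.lift_π_assoc, ← Functor.map_comp, ← Functor.map_sum]
          have := r.retract
          rw [← Category.id_comp r.r, ← biproduct.total, Preadditive.sum_comp,
            Preadditive.comp_sum] at this
          simp only [Category.assoc] at this ⊢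
          rw [this, CategoryTheory.Functor.map_id] }
  induction m generalizing X with
  | zero =>
    obtain ⟨V₀, hV₀, ⟨e⟩⟩ := h
    exact hadd _ (addClosure_of_retract e.symm.retract hV₀)
  | succ m ih =>
    obtain ⟨Z, V₀, i, p, w, hV₀, hS, hZ⟩ := h
    obtain ⟨f, g, h, hT⟩ := exists_distinguished_boundedSingle hS
    have hT' := rot_of_distTriang _ hT
    have := triangEnvelopeIter_of_distinguished
      (ObjectProperty.singleton (boundedSingle V)) (a := 0) (b := m) hT' (hadd _ hV₀)
      (ObjectProperty.le_shift _ (1 : ℤ) _ (ih hZ))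
    simpa using this

end BoundedDerived

/-! ### Complexes with zero differential and complexes of subobjects of projectives -/

section BoundedDerived

open Pretriangulated

attribute [local instance] Abelian.hasFiniteBiproducts

variable {C : Type u} [Category.{v} C] [Abelian C]

open DerivedCategory

lemma isSupported_single (X : C) (i : ℤ) :
    IsSupported ((HomologicalComplex.single C (ComplexShape.up ℤ) i).obj X) i i :=
  fun j hj => HomologicalComplex.isZero_single_obj_X _ _ _ _ (by lia)

variable [HasDerivedCategory.{w} C]

/-- A stalk complex is a shift of the stalk complex in degree `0`. -/
lemma prop_boundedQ_single {P : ObjectProperty (BoundedDerivedCategory C)}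
    [P.IsClosedUnderIsomorphisms] [P.IsStableUnderShift ℤ] {X : C} (hX : P (boundedSingle X))
    (i : ℤ) : P (boundedQ (isSupported_single X i)) := by
  refine ObjectProperty.prop_of_iso P ?_ (ObjectProperty.le_shift P (-i) _ hX)
  exact (TStructure.t (C := C)).bounded.fullyFaithfulι.preimageIso
    (((TStructure.t (C := C)).bounded.ι.commShiftIso (-i)).app (boundedSingle X) ≪≫
      ((singleFunctors C).shiftIso (-i) i 0 (by lia)).app X)

/-- A bounded complex with zero differential is a finite product of stalk complexes. -/
lemma prop_boundedQ_of_d_eq_zero {P : ObjectProperty (BoundedDerivedCategory C)}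
    [P.IsStableUnderRetracts] [P.IsClosedUnderFiniteProducts] [P.IsStableUnderShift ℤ]
    {K : CochainComplex C ℤ} {a b : ℤ} (hK : IsSupported K a b) (hd : ∀ i j, K.d i j = 0)
    (hP : ∀ i, P (boundedSingle (K.X i))) : P (boundedQ hK) := by
  let s (i : ℤ) : K ⟶ (HomologicalComplex.single C (ComplexShape.up ℤ) i).obj (K.X i) :=
    HomologicalComplex.mkHomToSingle (𝟙 _) (fun j _ => by simp [hd])
  let t (i : ℤ) : (HomologicalComplex.single C (ComplexShape.up ℤ) i).obj (K.X i) ⟶ K :=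
    HomologicalComplex.mkHomFromSingle (𝟙 _) (fun j _ => by simp [hd])
  have hst : ∑ i : Finset.Icc a b, s i ≫ t i = 𝟙 K := by
    ext j
    change (HomologicalComplex.eval C (ComplexShape.up ℤ) j).map _ = 𝟙 (K.X j)
    rw [Functor.map_sum]
    by_cases hj : a ≤ j ∧ j ≤ b
    · rw [Finset.sum_eq_single ⟨j, Finset.mem_Icc.mpr hj⟩]
      · simp [s, t]
        rfl
      · intro i _ hi
        have hij : j ≠ i := fun h => hi (Subtype.ext h.symm)
        simp only [HomologicalComplex.eval_map, HomologicalComplex.comp_f]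
        rw [(HomologicalComplex.isZero_single_obj_X _ _ _ _ hij).eq_of_tgt ((s i).f j) 0,
          zero_comp]
        rfl
      · simp
    · exact (hK j hj).eq_of_src _ _
  let F (i : Finset.Icc a b) : BoundedDerivedCategory C :=
    boundedQ (isSupported_single (K.X i) i)
  have h0 : P (∏ᶜ F) := ObjectProperty.prop_pi _ _ fun i => prop_boundedQ_single (hP i) i
  refine ObjectProperty.prop_of_retract _ ?_ h0
  exact
    { i := Pi.lift fun i => ObjectProperty.homMk (Q.map (s i))
      r := ∑ i, Pi.π F i ≫ ObjectProperty.homMk (Q.map (t i))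
      retract := by
        rw [Preadditive.comp_sum]
        simp only [Pi.lift_π_assoc]
        apply (TStructure.t (C := C)).bounded.ι.map_injective
        rw [Functor.map_sum, CategoryTheory.Functor.map_id]
        have : ∑ i : Finset.Icc a b, Q.map (s i) ≫ Q.map (t i) = 𝟙 (Q.obj K) := by
          simp only [← Functor.map_comp, ← Functor.map_sum]
          rw [hst, CategoryTheory.Functor.map_id]
        exact this }

/-- If all subobjects of the terms of a bounded complex have resolutions of length `m`, then the
complex is an extension of its coboundaries (shifted by one degree) by its cycles, which are
complexes with zero differential made of such subobjects. -/
lemma triangEnvelopeIter_boundedQ {V : C} {m : ℕ} {K : CochainComplex C ℤ} {a b : ℤ}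
    (hK : IsSupported K a b)
    (hV : ∀ (i : ℤ) (Y : C) (f : Y ⟶ K.X i) [Mono f],
      HasResolution (addClosure (ObjectProperty.singleton V)) m Y) :
    (ObjectProperty.singleton (boundedSingle V)).triangEnvelopeIter (2 * m + 1)
      (boundedQ hK) := by
  let Z : CochainComplex C ℤ := { X := fun i => K.cycles i, d := fun _ _ => 0 }
  let ι : Z ⟶ K := { f := fun i => K.iCycles i }
  have : ∀ i, Mono (ι.f i) := fun i => inferInstanceAs (Mono (K.iCycles i))
  have : Mono ι := HomologicalComplex.mono_of_mono_f _ this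
  let S : ShortComplex (CochainComplex C ℤ) := ShortComplex.mk ι (cokernel.π ι) (by simp)
  have hS : S.ShortExact := ⟨ShortComplex.exact_cokernel _⟩
  have hSi (i : ℤ) : (S.map (HomologicalComplex.eval C (ComplexShape.up ℤ) i)).ShortExact :=
    hS.map_of_exact _
  have hg (i : ℤ) : Epi (S.map (HomologicalComplex.eval C (ComplexShape.up ℤ) i)).g :=
    (hSi i).epi_g
  have hπ (i : ℤ) : Epi ((cokernel.π ι).f i) := (hSi i).epi_g
  have hd (i j : ℤ) : (cokernel ι).d i j = 0 := by
    rw [← cancel_epi ((cokernel.π ι).f i), comp_zero, HomologicalComplex.Hom.comm,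
      ← K.toCycles_i, Category.assoc]
    have : K.iCycles j ≫ (cokernel.π ι).f j = 0 := by
      have := congrArg (fun f => HomologicalComplex.Hom.f f j) (cokernel.condition ι)
      exact this
    rw [this, comp_zero]
  -- the cokernel of the cycles in degree `i` is the coboundary object in degree `i + 1`
  have hmono (i : ℤ) : ∃ f : (cokernel ι).X i ⟶ K.X (i + 1), Mono f := by
    let f : (cokernel ι).X i ⟶ K.X (i + 1) := (hSi i).exact.desc (K.d i (i + 1))
      (K.iCycles_d i (i + 1))
    have hf : (cokernel.π ι).f i ≫ f = K.d i (i + 1) := (hSi i).exact.g_desc _ _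
    refine ⟨f, Preadditive.mono_of_cancel_zero _ fun {A} x hx => ?_⟩
    obtain ⟨A', p, hp, y, hy⟩ := surjective_up_to_refinements_of_epi ((cokernel.π ι).f i) x
    have hy' : y ≫ K.d i (i + 1) = 0 := by
      rw [← hf, ← reassoc_of% hy, hx, comp_zero]
    have hz : K.liftCycles y (i + 1) (by simp) hy' ≫ K.iCycles i = y := K.liftCycles_i _ _ _ _
    rw [← cancel_epi p, comp_zero, hy, ← hz, Category.assoc]
    have : K.iCycles i ≫ (cokernel.π ι).f i = 0 :=
      congrArg (fun f => HomologicalComplex.Hom.f f i) (cokernel.condition ι)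
    rw [this, comp_zero]
  have h₁ : IsSupported Z a b := isSupported_of_mono ι hK
  have h₃ : IsSupported (cokernel ι) a b := fun i hi => (hK i hi).of_epi ((cokernel.π ι).f i)
  obtain ⟨f, g, h, hT⟩ := exists_distinguished_boundedQ hS h₁ hK h₃
  rw [show 2 * m + 1 = m + (m + 1) by lia]
  refine triangEnvelopeIter_of_distinguished _ hT ?_ ?_
  · refine prop_boundedQ_of_d_eq_zero h₁ (fun _ _ => rfl) fun i => ?_
    exact triangEnvelopeIter_of_hasResolution (hV i _ (K.iCycles i))
  · refine prop_boundedQ_of_d_eq_zero h₃ hd fun i => ?_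
    obtain ⟨f, hf⟩ := hmono i
    exact triangEnvelopeIter_of_hasResolution (hV (i + 1) _ f)

end BoundedDerived

/-! ### Resolutions bound the dimension of the bounded derived category -/

section BoundedDerived

open Pretriangulated

variable {C : Type u} [Category.{v} C] [Abelian C]

open CochainComplex CochainComplex.HomComplex

lemma exists_epi_projective [EnoughProjectives C] (X : C) :
    ∃ (P : C) (p : P ⟶ X), Projective P ∧ Epi p ∧ (IsZero X → IsZero P) := by
  by_cases hX : IsZero X
  -- The chosen cover of a zero object need not be zero.
  · exact ⟨X, 𝟙 X, ⟨fun f g _ => ⟨0, hX.eq_of_src _ _⟩⟩, inferInstance, id⟩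
  · exact ⟨Projective.over X, Projective.π X, inferInstance, inferInstance, fun h => (hX h).elim⟩

/-- A bounded complex is a quotient of a bounded contractible complex of projectives, namely of
the cone of the identity of a complex with zero differential. -/
lemma exists_epi_mappingCone [EnoughProjectives C] {K : CochainComplex C ℤ} {a b : ℤ}
    (hK : IsSupported K a b) :
    ∃ (G : CochainComplex C ℤ) (f : mappingCone (𝟙 G) ⟶ K), Epi f ∧
      (∀ i, Projective ((mappingCone (𝟙 G)).X i)) ∧
      IsSupported (mappingCone (𝟙 G)) a (b + 1) := by
  choose P p hP hp hP0 using exists_epi_projective (C := C)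
  -- The complex `G` is projective over `K` shifted by one degree, and the map from the cone of
  -- `𝟙 G` is `p` on the summand `G.X (i + 1) = P (K.X i)` in degree `i`, so it is epi.
  let G : CochainComplex C ℤ := { X := fun i => P (K.X (i - 1)), d := fun _ _ => 0 }
  let α : Cochain G K (-1) := Cochain.mk fun i j hij =>
    p (K.X (i - 1)) ≫ (K.XIsoOfEq (by lia)).hom
  let β : G ⟶ K := { f := fun i => p (K.X (i - 1)) ≫ K.d (i - 1) i }
  have e : δ (-1) 0 α = Cochain.ofHom (𝟙 G ≫ β) := by
    ext i
    rw [δ_v (-1) 0 (by lia) α i i (by lia) (i - 1) (i + 1) (by lia) (by lia)]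
    simp [α, β, G]
  have hG : IsSupported G (a + 1) (b + 1) := fun i hi => hP0 _ (hK _ (by lia))
  have hX (i : ℤ) : Nonempty ((mappingCone (𝟙 G)).X i ≅ G.X (i + 1) ⊞ G.X i) :=
    ⟨HomologicalComplex.homotopyCofiber.XIsoBiprod (𝟙 G) i (i + 1) rfl⟩
  refine ⟨G, mappingCone.desc (𝟙 G) α β e, ?_, fun i => ?_, fun i hi => ?_⟩
  · refine HomologicalComplex.epi_of_epi_f _ fun i => ?_
    have h := mappingCone.inl_v_desc_f (𝟙 G) α β e (i + 1) i (by lia)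
    have : Epi (α.v (i + 1) i (by lia)) := by
      simp only [α, Cochain.mk_v]
      infer_instance
    exact epi_of_epi_fac h
  · have : Projective (G.X (i + 1)) := hP _
    have : Projective (G.X i) := hP _
    exact Projective.of_iso (hX i).some.symm inferInstance
  · refine IsZero.of_iso ?_ (hX i).some
    exact biprod_isZero_iff _ _ |>.mpr ⟨hG _ (by lia), hG _ (by lia)⟩

variable [HasDerivedCategory.{w} C]

open DerivedCategory

lemma isZero_Q_mappingCone_id (G : CochainComplex C ℤ) :
    IsZero (Q.obj (mappingCone (𝟙 G))) := by
  have hT : Q.mapTriangle.obj (mappingCone.triangle (𝟙 G)) ∈ distTriang (DerivedCategory C) := by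
    rw [mem_distTriang_iff]
    exact ⟨_, _, _, ⟨Iso.refl _⟩⟩
  refine (Triangle.isZero₃_iff_isIso₁ _ hT).mpr ?_
  exact inferInstanceAs (IsIso (Q.map (𝟙 G)))

/-- If the subobjects of projective objects have resolutions of length `m` by `add V`, then every
bounded complex `K` is built from `V` by `2 * m + 1` cones: writing `K` as a quotient of a
contractible complex of projectives replaces it, up to a shift, by a complex whose terms, and
therefore whose cycles and boundaries, are subobjects of projective objects. -/
theorem triangEnvelopeIter_eq_top [EnoughProjectives C] {V : C} {m : ℕ}
    (hV : ∀ (Y P : C) (f : Y ⟶ P) [Mono f] [Projective P],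
      HasResolution (addClosure (ObjectProperty.singleton V)) m Y) :
    (ObjectProperty.singleton (boundedSingle V)).triangEnvelopeIter (2 * m + 1) = ⊤ := by
  rw [eq_top_iff]
  rintro X -
  obtain ⟨⟨a, ha⟩, ⟨b, hb⟩⟩ := X.property
  obtain ⟨K, ha', hb', ⟨e⟩⟩ := exists_iso_Q_obj_of_isGE_of_isLE X.obj a b
  have hK : IsSupported K a b := fun i hi => by
    by_cases h : i < a
    · exact K.isZero_of_isStrictlyGE a i h
    · exact K.isZero_of_isStrictlyLE b i (by lia)
  obtain ⟨G, f, hf, hP, hG⟩ := exists_epi_mappingCone hK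
  let S : ShortComplex (CochainComplex C ℤ) := ShortComplex.mk (kernel.ι f) f (by simp)
  have hS : S.ShortExact := ⟨ShortComplex.exact_kernel _⟩
  have hmono (i : ℤ) : Mono ((kernel.ι f).f i) :=
    (hS.map_of_exact (HomologicalComplex.eval C (ComplexShape.up ℤ) i)).mono_f
  have hK' : IsSupported K a (b + 1) := fun i hi => hK i (by lia)
  have hL : IsSupported (kernel f) a (b + 1) := isSupported_of_mono (kernel.ι f) hG
  have hVL := triangEnvelopeIter_boundedQ (V := V) (m := m) hL fun i Y g _ => by
    have := hP i
    exact hV Y _ (g ≫ (kernel.ι f).f i)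
  obtain ⟨f', g', h', hT⟩ := exists_distinguished_boundedQ hS hL hG hK'
  have hz : IsZero (boundedQ hG) := by
    rw [IsZero.iff_id_eq_zero]
    apply (TStructure.t (C := C)).bounded.ι.map_injective
    exact (isZero_Q_mappingCone_id G).eq_of_src _ _
  have : IsIso h' := (Triangle.isZero₂_iff_isIso₃ _ hT).mp hz
  refine ObjectProperty.prop_of_iso _ ?_ (ObjectProperty.le_shift _ (1 : ℤ) _ hVL)
  refine (asIso h').symm ≪≫ ?_
  exact (TStructure.t (C := C)).bounded.fullyFaithfulι.preimageIso e.symm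

theorem triDim_le_of_hasResolution [EnoughProjectives C] {V : C} {m : ℕ}
    (hV : ∀ (Y P : C) (f : Y ⟶ P) [Mono f] [Projective P],
      HasResolution (addClosure (ObjectProperty.singleton V)) m Y) :
    triDim (BoundedDerivedCategory C) ≤ 2 * m + 1 := by
  have : triDim (BoundedDerivedCategory C) ≤ ((2 * m + 1 : ℕ) : ℕ∞) :=
    iInf₂_le (2 * m + 1) ⟨_, triangEnvelopeIter_eq_top hV⟩
  exact_mod_cast this

end BoundedDerived

/-! ### Finitely generated modules and restriction of scalars -/

section FGModules

attribute [local instance] Abelian.hasFiniteBiproducts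

variable {A : Type u} [Ring A] [IsNoetherianRing A]

lemma epi_iff_surjective {X Y : FGModuleCat.{u} A} (f : X ⟶ Y) :
    Epi f ↔ Function.Surjective f.hom.hom := by
  rw [← ModuleCat.epi_iff_surjective]
  exact ⟨fun _ => inferInstanceAs (Epi ((forget₂ (FGModuleCat A) (ModuleCat A)).map f)),
    fun h => (forget₂ (FGModuleCat A) (ModuleCat A)).epi_of_epi_map h⟩

lemma mono_iff_injective {X Y : FGModuleCat.{u} A} (f : X ⟶ Y) :
    Mono f ↔ Function.Injective f.hom.hom := by
  rw [← ModuleCat.mono_iff_injective]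
  exact ⟨fun _ => inferInstanceAs (Mono ((forget₂ (FGModuleCat A) (ModuleCat A)).map f)),
    fun h => (forget₂ (FGModuleCat A) (ModuleCat A)).mono_of_mono_map h⟩

lemma shortExact_iff (S : ShortComplex (FGModuleCat.{u} A)) :
    S.ShortExact ↔ Function.Injective S.f.hom.hom ∧ Function.Exact S.f.hom.hom S.g.hom.hom ∧
      Function.Surjective S.g.hom.hom := by
  have h : S.Exact ↔ Function.Exact S.f.hom.hom S.g.hom.hom := by
    rw [← ShortComplex.exact_map_iff_of_faithful S (forget₂ (FGModuleCat A) (ModuleCat A)),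
      ShortComplex.ShortExact.moduleCat_exact_iff_function_exact]
    rfl
  rw [← mono_iff_injective, ← epi_iff_surjective, ← h]
  exact ⟨fun h => ⟨h.mono_f, h.exact, h.epi_g⟩,
    fun h => { exact := h.2.1, mono_f := h.1, epi_g := h.2.2 }⟩

/-- The short complex given by the kernel of a linear map. -/
abbrev kernelShortComplex {X Y : FGModuleCat.{u} A} (f : X ⟶ Y) :
    ShortComplex (FGModuleCat.{u} A) :=
  ShortComplex.mk (X₁ := FGModuleCat.of A (LinearMap.ker f.hom.hom))
    (FGModuleCat.ofHom (LinearMap.ker f.hom.hom).subtype) f (by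
      ext x
      exact x.2)

lemma kernelShortComplex_shortExact {X Y : FGModuleCat.{u} A} (f : X ⟶ Y)
    (hf : Function.Surjective f.hom.hom) : (kernelShortComplex f).ShortExact := by
  rw [shortExact_iff]
  refine ⟨Subtype.val_injective, fun x => ?_, hf⟩
  exact ⟨fun hx => ⟨⟨x, hx⟩, rfl⟩, fun ⟨y, hy⟩ => hy ▸ y.2⟩

lemma projective_of_moduleProjective (P : FGModuleCat.{u} A) [Module.Projective A P] :
    Projective P where
  factors {E X} f e _ := by
    obtain ⟨g, hg⟩ := Module.projective_lifting_property e.hom.hom f.hom.hom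
      ((epi_iff_surjective e).mp inferInstance)
    exact ⟨FGModuleCat.ofHom g, by ext x; exact LinearMap.congr_fun hg x⟩

omit [IsNoetherianRing A] in
lemma exists_surjective_of_free (X : FGModuleCat.{u} A) :
    ∃ (k : ℕ) (f : (Fin k → A) →ₗ[A] X), Function.Surjective f :=
  Module.Finite.exists_fin' A X

instance : EnoughProjectives (FGModuleCat.{u} A) where
  presentation X := by
    obtain ⟨k, f, hf⟩ := exists_surjective_of_free X
    exact ⟨{  p := FGModuleCat.of A (Fin k → A)
              projective := projective_of_moduleProjective _
              f := FGModuleCat.ofHom f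
              epi := (epi_iff_surjective _).mpr hf }⟩

lemma exists_retract_of_projective (P : FGModuleCat.{u} A) [Projective P] :
    ∃ (k : ℕ), Nonempty (Retract P (FGModuleCat.of A (Fin k → A))) := by
  obtain ⟨k, f, hf⟩ := exists_surjective_of_free P
  have : Epi (FGModuleCat.ofHom f) := (epi_iff_surjective _).mpr hf
  exact ⟨k, ⟨⟨Projective.factorThru (𝟙 P) (FGModuleCat.ofHom f), FGModuleCat.ofHom f,
    Projective.factorThru_comp _ _⟩⟩⟩

lemma moduleProjective_of_projective (P : FGModuleCat.{u} A) [Projective P] :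
    Module.Projective A P := by
  obtain ⟨k, ⟨r⟩⟩ := exists_retract_of_projective P
  refine Module.Projective.of_split r.i.hom.hom r.r.hom.hom ?_
  have := congrArg (fun f => f.hom.hom) r.retract
  exact this

lemma addClosure_of_fin_fun (k : ℕ) :
    addClosure (ObjectProperty.singleton (FGModuleCat.of A A)) (FGModuleCat.of A (Fin k → A)) := by
  refine addClosure_of_retract ?_
    (addClosure_biproduct (fun _ : Fin k => FGModuleCat.of A A) fun _ => addClosure_self _)
  let P (i : Fin k) : FGModuleCat.of A (Fin k → A) ⟶ FGModuleCat.of A A :=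
    FGModuleCat.ofHom (LinearMap.proj i)
  let I (i : Fin k) : FGModuleCat.of A A ⟶ FGModuleCat.of A (Fin k → A) :=
    FGModuleCat.ofHom (LinearMap.single A (fun _ : Fin k => A) i)
  exact
    { i := biproduct.lift P
      r := biproduct.desc I
      retract := by
        rw [biproduct.lift_desc]
        have : (∑ i, P i ≫ I i).hom.hom = LinearMap.id := by
          have h : (∑ i, P i ≫ I i).hom.hom = ∑ i, (P i ≫ I i).hom.hom :=
            map_sum ({ toFun := fun f => f.hom.hom, map_zero' := rfl, map_add' := fun _ _ => rfl } :
              (FGModuleCat.of A (Fin k → A) ⟶ FGModuleCat.of A (Fin k → A)) →+ _) _ _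
          rw [h]
          refine LinearMap.ext fun x => funext fun j => ?_
          rw [LinearMap.sum_apply, Finset.sum_apply]
          change ∑ c, (Pi.single c (x c) : Fin k → A) j = x j
          simp [Pi.single_apply]
        exact FGModuleCat.hom_ext this }

lemma addClosure_of_projective (P : FGModuleCat.{u} A) [Projective P] :
    addClosure (ObjectProperty.singleton (FGModuleCat.of A A)) P := by
  obtain ⟨k, ⟨r⟩⟩ := exists_retract_of_projective P
  exact addClosure_of_retract r (addClosure_of_fin_fun k)

end FGModules

section Restriction

variable {R : Type v} [CommRing R] [IsArtinianRing R] {E : Type u} [Ring E] [Algebra R E]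
  [Module.Finite R E] {A B : Subalgebra R E}

instance finite_subalgebra (A : Subalgebra R E) : Module.Finite R A :=
  inferInstanceAs (Module.Finite R (Subalgebra.toSubmodule A))

lemma finite_restrictScalars_inclusion (h : A ≤ B) (M : FGModuleCat.{u} B) :
    Module.Finite A ((ModuleCat.restrictScalars (Subalgebra.inclusion h).toRingHom).obj M.obj) := by
  let _ : Module A B := Module.compHom B (Subalgebra.inclusion h).toRingHom
  let _ : Module A M := Module.compHom M (Subalgebra.inclusion h).toRingHom
  have : IsScalarTower R A B := ⟨fun r a b => by
    apply Subtype.ext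
    exact smul_mul_assoc r (a : E) (b : E)⟩
  have : Module.Finite A B := Module.Finite.of_restrictScalars_finite R A B
  have : IsScalarTower A B M := ⟨fun a b x => mul_smul (Subalgebra.inclusion h a) b x⟩
  have : Module.Finite A M := Module.Finite.trans B M
  exact this

/-- Restriction of scalars of finitely generated modules along an inclusion of subalgebras. -/
noncomputable def restrictFG (h : A ≤ B) : FGModuleCat.{u} B ⥤ FGModuleCat.{u} A :=
  (ModuleCat.isFG A).lift
    ((ModuleCat.isFG B).ι ⋙ ModuleCat.restrictScalars (Subalgebra.inclusion h).toRingHom)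
    (finite_restrictScalars_inclusion h)

instance (h : A ≤ B) : (restrictFG h).Additive where
  map_add := rfl

lemma restrictFG_shortExact (h : A ≤ B) {S : ShortComplex (FGModuleCat.{u} B)}
    (hS : S.ShortExact) : (S.map (restrictFG h)).ShortExact := by
  rw [shortExact_iff] at hS ⊢
  exact hS

/-- The same additive group, with the action of `A` through `A ≤ B`. -/
noncomputable def restrictFGEquiv (h : A ≤ B) (M : FGModuleCat.{u} B) : (restrictFG h).obj M ≃+ M :=
  AddEquiv.refl _

end Restriction

/-! ### Projective covers over artinian rings -/

section ProjectiveCovers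

variable {A : Type u} [Ring A] [IsArtinianRing A]

lemma isSemisimpleModule_of_jacobson_smul {M : Type*} [AddCommGroup M] [Module A M]
    (h : ∀ a ∈ Ring.jacobson A, ∀ x : M, a • x = 0) : IsSemisimpleModule A M := by
  have hM : Module.IsTorsionBySet A M (Ring.jacobson A) := fun x a => h a a.2 x
  let _ := hM.module
  exact hM.isSemisimpleModule_iff.mp inferInstance

lemma exists_compl_of_jacobson_smul {M : Type*} [AddCommGroup M] [Module A M]
    (h : ∀ a ∈ Ring.jacobson A, ∀ x : M, a • x = 0) (N : Submodule A M) :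
    ∃ N', IsCompl N N' := by
  have := isSemisimpleModule_of_jacobson_smul h
  exact exists_isCompl N

/-- A submodule that is superfluous lies in `rad M = J M`, because it has a complement modulo
`J M`. -/
lemma le_jacobson_smul_top {M : Type*} [AddCommGroup M] [Module A M] (K : Submodule A M)
    (hK : ∀ N : Submodule A M, K ⊔ N = ⊤ → N = ⊤) : K ≤ Ring.jacobson A • (⊤ : Submodule A M) := by
  let JM := Ring.jacobson A • (⊤ : Submodule A M)
  obtain ⟨N', hN'⟩ := exists_compl_of_jacobson_smul (A := A) (M := M ⧸ JM) (fun a ha x => by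
    obtain ⟨x, rfl⟩ := JM.mkQ_surjective x
    rw [← map_smul]
    exact (Submodule.Quotient.mk_eq_zero _).mpr
      (Submodule.smul_mem_smul ha Submodule.mem_top)) (K.map JM.mkQ)
  have h1 : K ⊔ N'.comap JM.mkQ = ⊤ := by
    rw [eq_top_iff]
    rintro x -
    have hx : JM.mkQ x ∈ K.map JM.mkQ ⊔ N' := by rw [hN'.sup_eq_top]; trivial
    obtain ⟨_, ⟨k, hk, rfl⟩, n, hn, hkn⟩ := Submodule.mem_sup.mp hx
    refine Submodule.mem_sup.mpr ⟨k, hk, x - k, ?_, by abel⟩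
    change JM.mkQ (x - k) ∈ N'
    rw [map_sub, ← hkn, add_sub_cancel_left]
    exact hn
  have h2 := hK _ h1
  have h3 : N' = ⊤ := by
    rw [eq_top_iff]
    rintro x -
    obtain ⟨x, rfl⟩ := JM.mkQ_surjective x
    have : x ∈ N'.comap JM.mkQ := by rw [h2]; trivial
    exact this
  intro x hx
  have : JM.mkQ x ∈ K.map JM.mkQ ⊓ N' := ⟨⟨x, hx, rfl⟩, by rw [h3]; trivial⟩
  rw [hN'.inf_eq_bot] at this
  exact (Submodule.Quotient.mk_eq_zero _).mp this

lemma IsProjectiveCover.ker_le {P X : FGModuleCat.{u} A} {p : P ⟶ X} (hp : IsProjectiveCover p) :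
    LinearMap.ker p.hom.hom ≤ Ring.jacobson A • (⊤ : Submodule A P) := by
  have := hp.epi
  refine le_jacobson_smul_top _ fun N hN => ?_
  have hs : Epi (FGModuleCat.ofHom N.subtype : FGModuleCat.of A N ⟶ P) := by
    apply hp.essential
    rw [epi_iff_surjective]
    intro x
    obtain ⟨y, rfl⟩ := (epi_iff_surjective p).mp inferInstance x
    have hy : y ∈ LinearMap.ker p.hom.hom ⊔ N := by rw [hN]; trivial
    obtain ⟨k, hk, n, hn, rfl⟩ := Submodule.mem_sup.mp hy
    refine ⟨⟨n, hn⟩, ?_⟩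
    rw [map_add, LinearMap.mem_ker.mp hk, zero_add]
    rfl
  rw [epi_iff_surjective] at hs
  rw [eq_top_iff]
  rintro x -
  obtain ⟨y, rfl⟩ := hs x
  exact y.2

/-- Projective covers exist over artinian rings: take a projective module of minimal length that
maps onto `X`. If `g ≫ p` is an epimorphism then `g` is a factor of an endomorphism `φ` of `P`
over `X`; by Fitting's lemma and minimality `φ` is surjective. -/
theorem exists_isProjectiveCover (X : FGModuleCat.{u} A) :
    ∃ (P : FGModuleCat.{u} A) (p : P ⟶ X), IsProjectiveCover p := by
  let S : Set ℕ∞ := {l | ∃ (P : FGModuleCat.{u} A) (p : P ⟶ X), Projective P ∧ Epi p ∧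
    Module.length A P = l}
  have hS : S.Nonempty := ⟨_, _, Projective.π X, inferInstance, inferInstance, rfl⟩
  obtain ⟨P, p, hP, hp, hl⟩ := wellFounded_lt.min_mem S hS
  refine ⟨P, p, hP, hp, fun {Q} g hg => ?_⟩
  let h : P ⟶ Q := Projective.factorThru p (g ≫ p)
  have hh : h ≫ g ≫ p = p := Projective.factorThru_comp _ _
  let φ : Module.End A P := (h ≫ g).hom.hom
  have hφ (x : P) : p.hom.hom (φ x) = p.hom.hom x :=
    congrArg (fun f => f.hom.hom x) hh
  have hφn (n : ℕ) (x : P) : p.hom.hom ((φ ^ n) x) = p.hom.hom x := by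
    induction n with
    | zero => simp
    | succ n ih => rw [pow_succ', Module.End.mul_apply, hφ, ih]
  obtain ⟨n, hn1, hn⟩ := ((Filter.eventually_ge_atTop 1).and
    (LinearMap.eventually_isCompl_ker_pow_range_pow φ)).exists
  let N := LinearMap.range (φ ^ n)
  have hPm := moduleProjective_of_projective P
  have hN : Module.Projective A N :=
    Module.Projective.of_split N.subtype (Submodule.projectionOnto N _ hn.symm) (by
      ext x
      simp)
  have hmem : Module.length A N ∈ S := by
    refine ⟨FGModuleCat.of A N, FGModuleCat.ofHom (p.hom.hom ∘ₗ N.subtype),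
      projective_of_moduleProjective _, ?_, rfl⟩
    rw [epi_iff_surjective]
    intro x
    obtain ⟨y, rfl⟩ := (epi_iff_surjective p).mp hp x
    exact ⟨⟨(φ ^ n) y, y, rfl⟩, hφn n y⟩
  have hNtop : N = ⊤ := by
    by_contra hne
    exact wellFounded_lt.not_lt_min S hmem (hl ▸ Submodule.length_lt hne)
  rw [epi_iff_surjective]
  intro x
  have hx : x ∈ N := by rw [hNtop]; trivial
  obtain ⟨y, rfl⟩ := hx
  obtain ⟨n, rfl⟩ := Nat.exists_eq_succ_of_ne_zero (Nat.one_le_iff_ne_zero.mp hn1)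
  rw [pow_succ', Module.End.mul_apply]
  exact ⟨_, rfl⟩

end ProjectiveCovers

/-! ### Injective modules over artin algebras -/

section EssentialExtensions

variable {A : Type u} [Ring A]

/-- An injective linear map is an essential extension if every nonzero submodule of the target
meets its range. -/
structure IsEssentialExtension {M E : Type*} [AddCommGroup M] [AddCommGroup E] [Module A M]
    [Module A E] (j : M →ₗ[A] E) : Prop where
  injective : Function.Injective j
  eq_bot : ∀ W : Submodule A E, W ⊓ LinearMap.range j = ⊥ → W = ⊥

lemma IsEssentialExtension.comp {M E N : Type*} [AddCommGroup M] [AddCommGroup E] [AddCommGroup N]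
    [Module A M] [Module A E] [Module A N] {s : E →ₗ[A] N} {j : M →ₗ[A] E}
    (hs : IsEssentialExtension s) (hj : IsEssentialExtension j) :
    IsEssentialExtension (s ∘ₗ j) where
  injective := hs.injective.comp hj.injective
  eq_bot W hW := by
    have h1 : W.comap s = ⊥ := hj.eq_bot _ (by
      rw [eq_bot_iff]
      rintro _ ⟨hx, y, rfl⟩
      have : s (j y) ∈ W ⊓ LinearMap.range (s ∘ₗ j) := ⟨hx, y, rfl⟩
      rw [hW] at this
      exact (map_eq_zero_iff s hs.injective).mp this)
    refine hs.eq_bot _ ?_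
    rw [eq_bot_iff]
    rintro _ ⟨hx, y, rfl⟩
    have : y ∈ W.comap s := hx
    rw [h1] at this
    rw [(Submodule.mem_bot A).mp this, map_zero]
    exact Submodule.zero_mem _

/-- An injective map into a noetherian module becomes essential modulo a maximal submodule that
does not meet its range. -/
lemma exists_isEssentialExtension_mkQ {E N : Type*} [AddCommGroup E] [AddCommGroup N]
    [Module A E] [Module A N] [IsNoetherian A N] (s : E →ₗ[A] N) (hs : Function.Injective s) :
    ∃ Q : Submodule A N, IsEssentialExtension (Q.mkQ ∘ₗ s) := by
  obtain ⟨Q, hQ, hmax⟩ := set_has_maximal_iff_noetherian.mpr ‹IsNoetherian A N›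
    {Q : Submodule A N | Q ⊓ LinearMap.range s = ⊥} ⟨⊥, bot_inf_eq _⟩
  have hQ' (x : E) (hx : s x ∈ Q) : x = 0 := by
    have : s x ∈ Q ⊓ LinearMap.range s := ⟨hx, x, rfl⟩
    rw [Set.mem_ofPred_eq.mp hQ] at this
    exact (map_eq_zero_iff s hs).mp this
  refine ⟨Q, (injective_iff_map_eq_zero _).mpr fun x hx =>
    hQ' x ((Submodule.Quotient.mk_eq_zero Q).mp hx), fun W hW => ?_⟩
  have hle : Q ≤ W.comap Q.mkQ := fun x hx => by
    change Q.mkQ x ∈ W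
    have : Q.mkQ x = 0 := (Submodule.Quotient.mk_eq_zero Q).mpr hx
    rw [this]
    exact W.zero_mem
  have hmem : W.comap Q.mkQ ⊓ LinearMap.range s = ⊥ := by
    rw [eq_bot_iff]
    rintro _ ⟨hx, y, rfl⟩
    have : Q.mkQ (s y) ∈ W ⊓ LinearMap.range (Q.mkQ ∘ₗ s) := ⟨hx, y, rfl⟩
    rw [hW] at this
    rw [hQ' y ((Submodule.Quotient.mk_eq_zero Q).mp this), map_zero]
    exact Submodule.zero_mem _
  have heq : Q = W.comap Q.mkQ := hle.eq_of_not_lt (hmax _ hmem)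
  rw [eq_bot_iff]
  intro x hx
  obtain ⟨x, rfl⟩ := Q.mkQ_surjective x
  have : x ∈ Q := by
    rw [heq]
    exact hx
  exact (Submodule.Quotient.mk_eq_zero Q).mpr this

variable [IsArtinianRing A]

lemma exists_jacobson_pow_eq_bot : ∃ n, Ring.jacobson A ^ n = ⊥ :=
  IsSemiprimaryRing.isNilpotent

/-- The radical is nilpotent, so every nonzero module contains a nonzero element killed by it. -/
lemma exists_mem_jacobson_smul_eq_zero {X : Type*} [AddCommGroup X] [Module A X]
    {W : Submodule A X} (hW : W ≠ ⊥) :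
    ∃ y ∈ W, y ≠ 0 ∧ ∀ a ∈ Ring.jacobson A, a • y = 0 := by
  obtain ⟨N, hN⟩ := exists_jacobson_pow_eq_bot (A := A)
  have hex : ∃ n, ∀ a ∈ Ring.jacobson A ^ n, ∀ x ∈ W, a • x = 0 := ⟨N, fun a ha x _ => by
    rw [hN] at ha
    rw [(Submodule.mem_bot A).mp ha, zero_smul]⟩
  classical
  obtain hn | ⟨n, hn⟩ : Nat.find hex = 0 ∨ ∃ n, Nat.find hex = n + 1 := by
    cases h : Nat.find hex with
    | zero => exact Or.inl rfl
    | succ n => exact Or.inr ⟨n, rfl⟩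
  · have h := Nat.find_spec hex
    rw [hn, Submodule.pow_zero] at h
    refine absurd (eq_bot_iff.mpr fun x hx => ?_) hW
    have := h 1 (by rw [Ideal.one_eq_top]; trivial) x hx
    rwa [one_smul] at this
  · have h := Nat.find_spec hex
    have h' := Nat.find_min hex (m := n) (by omega)
    push Not at h'
    obtain ⟨a, ha, x, hx, hax⟩ := h'
    refine ⟨a • x, W.smul_mem a hx, hax, fun b hb => ?_⟩
    rw [smul_smul]
    refine h _ ?_ x hx
    rw [hn, Ideal.IsTwoSided.pow_succ]
    exact Ideal.mul_mem_mul hb ha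

/-- The elements killed by the radical form a semisimple module, so an essential submodule
contains all of them. -/
lemma IsEssentialExtension.mem_range {M E : Type*} [AddCommGroup M] [AddCommGroup E] [Module A M]
    [Module A E] {j : M →ₗ[A] E} (hj : IsEssentialExtension j) {x : E}
    (hx : ∀ a ∈ Ring.jacobson A, a • x = 0) : x ∈ LinearMap.range j := by
  let T : Submodule A E := Submodule.span A {x}
  obtain ⟨N, hN⟩ := exists_compl_of_jacobson_smul (A := A) (M := T) (fun a ha y => by
    obtain ⟨c, hc⟩ := Submodule.mem_span_singleton.mp y.2
    apply Subtype.ext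
    change a • (y : E) = 0
    rw [← hc, smul_smul]
    exact hx _ (Ideal.mul_mem_right _ _ ha)) ((LinearMap.range j).comap T.subtype)
  have h1 : N.map T.subtype = ⊥ := hj.eq_bot _ (by
    rw [eq_bot_iff]
    rintro _ ⟨⟨y, hy, rfl⟩, hy'⟩
    have : y ∈ (LinearMap.range j).comap T.subtype ⊓ N := ⟨hy', hy⟩
    rw [hN.inf_eq_bot] at this
    rw [(Submodule.mem_bot A).mp this, map_zero]
    exact Submodule.zero_mem _)
  have h2 : N = ⊥ := by
    rw [eq_bot_iff]
    intro y hy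
    have : (y : E) ∈ N.map T.subtype := ⟨y, hy, rfl⟩
    rw [h1] at this
    exact Subtype.ext this
  have h3 := hN.sup_eq_top
  rw [h2, sup_bot_eq] at h3
  have : (⟨x, Submodule.mem_span_singleton_self x⟩ : T) ∈
      (LinearMap.range j).comap T.subtype := by rw [h3]; trivial
  exact this

end EssentialExtensions

section Injectives

attribute [local instance] Abelian.hasFiniteBiproducts

/-- The length over `R` of an essential extension `E` of `M` is bounded. With `g` generators of
the radical `J`, and `F n` the elements of `E` killed by `J ^ n`, the length of `F (n + 1)` is at
most the length of `M` plus `g` times the length of `F n`. -/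
lemma exists_length_le_of_isEssentialExtension (R : Type v) [CommRing R] [IsArtinianRing R] {A : Type u}
    [Ring A] [Algebra R A] [Module.Finite R A]
    (M : Type u) [AddCommGroup M] [Module A M] [Module.Finite A M] :
    ∃ b : ℕ, ∀ (E : Type u) [AddCommGroup E] [Module A E] (j : M →ₗ[A] E),
      IsEssentialExtension j → Module.length A E ≤ b := by
  have : IsArtinianRing A := isArtinian_of_tower R inferInstance
  let _ : Module R M := Module.compHom M (algebraMap R A)
  have : IsScalarTower R A M := ⟨fun r a x => by
    rw [Algebra.smul_def, mul_smul]; rfl⟩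
  have : Module.Finite R M := Module.Finite.trans A M
  obtain ⟨g, r, hr⟩ := Submodule.fg_iff_exists_fin_generating_family.mp
    (IsNoetherian.noetherian (Ring.jacobson A))
  have hrJ (i : Fin g) : r i ∈ Ring.jacobson A := by
    rw [← hr]
    exact Submodule.subset_span ⟨i, rfl⟩
  obtain ⟨N, hN⟩ := exists_jacobson_pow_eq_bot (A := A)
  obtain ⟨L, hL⟩ := ENat.ne_top_iff_exists.mp (Module.length_ne_top (R := R) (M := M))
  obtain ⟨b, hb⟩ : ∃ b : ℕ → ℕ, ∀ n, b (n + 1) = L + g * b n :=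
    ⟨fun n => n.rec 0 fun _ c => L + g * c, fun _ => rfl⟩
  refine ⟨b N, fun E _ _ j hj => ?_⟩
  let _ : Module R E := Module.compHom E (algebraMap R A)
  have : IsScalarTower R A E := ⟨fun r a x => by
    rw [Algebra.smul_def, mul_smul]; rfl⟩
  have : SMulCommClass R A E := IsScalarTower.to_smulCommClass
  let F (n : ℕ) : Submodule R E :=
    { carrier := {x | ∀ a ∈ Ring.jacobson A ^ n, a • x = 0}
      add_mem' := fun hx hy a ha => by rw [smul_add, hx a ha, hy a ha, add_zero]
      zero_mem' := fun a _ => smul_zero a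
      smul_mem' := fun c x hx a ha => by rw [← smul_comm c a x, hx a ha, smul_zero] }
  have hF (n : ℕ) : Module.length R (F n) ≤ (b n : ℕ∞) := by
    induction n with
    | zero =>
      have : Subsingleton (F 0) := (Submodule.subsingleton_iff_eq_bot).mpr (by
        rw [eq_bot_iff]
        intro x hx
        have := hx 1 (by rw [Submodule.pow_zero, Ideal.one_eq_top]; trivial)
        rwa [one_smul] at this)
      rw [Module.length_eq_zero]
      exact zero_le
    | succ n ih =>
      let φ : F (n + 1) →ₗ[R] (Fin g → F n) := LinearMap.pi fun i =>
        { toFun := fun x => ⟨r i • (x : E), fun a ha => by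
            rw [smul_smul]
            refine x.2 _ ?_
            rw [Submodule.pow_succ]
            exact Ideal.mul_mem_mul ha (hrJ i)⟩
          map_add' := fun x y => Subtype.ext (smul_add _ _ _)
          map_smul' := fun c x => Subtype.ext (smul_comm _ _ _) }
      rw [Module.length_eq_add_of_exact (LinearMap.ker φ).subtype φ.rangeRestrict
        Subtype.val_injective φ.surjective_rangeRestrict
        (LinearMap.exact_iff.mpr (by rw [LinearMap.ker_rangeRestrict, Submodule.range_subtype]))]
      have hker (x : LinearMap.ker φ) : ((x : F (n + 1)) : E) ∈ LinearMap.range j := by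
        refine hj.mem_range fun a ha => ?_
        rw [← hr] at ha
        induction ha using Submodule.span_induction with
        | mem _ h =>
          obtain ⟨i, rfl⟩ := h
          exact congrArg Subtype.val (congrFun (LinearMap.mem_ker.mp x.2) i)
        | zero => exact zero_smul _ _
        | add _ _ _ _ h1 h2 => rw [add_smul, h1, h2, add_zero]
        | smul c _ _ h => rw [smul_assoc, h, smul_zero]
      have h1 : Module.length R (LinearMap.ker φ) ≤ L := by
        rw [hL]
        have e : M ≃ₗ[R] LinearMap.range (j.restrictScalars R) :=
          LinearEquiv.ofInjective (j.restrictScalars R) hj.injective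
        rw [e.length_eq]
        exact Module.length_le_of_injective
          (((F (n + 1)).subtype ∘ₗ (LinearMap.ker φ).subtype).codRestrict _ hker)
          fun x y h => Subtype.ext (Subtype.ext (Subtype.ext_iff.mp h :))
      have h2 : Module.length R (LinearMap.range φ) ≤ (g : ℕ∞) * (b n : ℕ∞) := by
        refine (Module.length_le_of_injective (LinearMap.range φ).subtype
          Subtype.val_injective).trans ?_
        rw [Module.length_pi_of_fintype, Finset.sum_const, Finset.card_univ, Fintype.card_fin,
          nsmul_eq_mul]
        gcongr
      refine (add_le_add h1 h2).trans ?_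
      rw [hb]
      push_cast
      exact le_rfl
  have htop : F N = ⊤ := by
    rw [eq_top_iff]
    intro x _ a ha
    rw [hN] at ha
    rw [(Submodule.mem_bot A).mp ha, zero_smul]
  have h1 := Submodule.length_le_length_restrictScalars R (⊤ : Submodule A E)
  have h2 : (⊤ : Submodule A E).restrictScalars R = F N := htop.symm
  rw [h2, Submodule.topEquiv.length_eq] at h1
  exact h1.trans (hF N)

/-- Every finitely generated module embeds in a finitely generated injective module: an essential
extension of maximal length has no proper essential extension, hence splits off from every
finitely generated module that contains it. -/
theorem exists_injective_mono (R : Type v) [CommRing R] [IsArtinianRing R] {A : Type u}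
    [Ring A] [Algebra R A] [Module.Finite R A]
    [IsNoetherianRing A] (M : FGModuleCat.{u} A) :
    ∃ (E : FGModuleCat.{u} A) (j : M ⟶ E), Injective E ∧ Mono j := by
  have : IsArtinianRing A := isArtinian_of_tower R inferInstance
  obtain ⟨b, hb⟩ := exists_length_le_of_isEssentialExtension R (A := A) M
  let S : Set ℕ := {l | ∃ (E : FGModuleCat.{u} A) (j : M →ₗ[A] E), IsEssentialExtension j ∧
    Module.length A E = l}
  have hS : S.Nonempty := by
    obtain ⟨l, hl⟩ := ENat.ne_top_iff_exists.mp (Module.length_ne_top (R := A) (M := M))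
    refine ⟨l, M, LinearMap.id, ⟨Function.injective_id, fun W hW => ?_⟩, hl.symm⟩
    rwa [LinearMap.range_id, inf_top_eq] at hW
  have hbdd : BddAbove S := ⟨b, fun l ⟨E, j, hj, hl⟩ => by
    have := hb E j hj
    rw [hl] at this
    exact_mod_cast this⟩
  obtain ⟨E, j, hj, hl⟩ := Nat.sSup_mem hS hbdd
  have hsplit (N : FGModuleCat.{u} A) (s : E →ₗ[A] N) (hs : Function.Injective s) :
      ∃ t : N →ₗ[A] E, t ∘ₗ s = LinearMap.id := by
    obtain ⟨Q, hQ⟩ := exists_isEssentialExtension_mkQ s hs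
    have hsurj : Function.Surjective (Q.mkQ ∘ₗ s) := by
      rw [← LinearMap.range_eq_top]
      by_contra hne
      have hlt := Submodule.length_lt hne
      rw [← (LinearEquiv.ofInjective _ hQ.injective).length_eq, hl] at hlt
      obtain ⟨l, hl'⟩ := ENat.ne_top_iff_exists.mp (Module.length_ne_top (R := A) (M := N ⧸ Q))
      have hmem : l ∈ S := ⟨FGModuleCat.of A (N ⧸ Q), _, hQ.comp hj, hl'.symm⟩
      rw [← hl'] at hlt
      exact absurd (le_csSup hbdd hmem) (not_le.mpr (by exact_mod_cast hlt))
    let e := LinearEquiv.ofBijective _ ⟨hQ.injective, hsurj⟩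
    exact ⟨e.symm.toLinearMap ∘ₗ Q.mkQ, LinearMap.ext fun x => e.symm_apply_apply x⟩
  refine ⟨E, FGModuleCat.ofHom j, ⟨fun {X Y} g f _ => ?_⟩,
    (mono_iff_injective _).mpr hj.injective⟩
  obtain ⟨t, ht⟩ := hsplit (pushout g f) (pushout.inl g f).hom.hom
    ((mono_iff_injective _).mp inferInstance)
  have ht' : pushout.inl g f ≫ FGModuleCat.ofHom t = 𝟙 E :=
    FGModuleCat.hom_ext ht
  exact ⟨pushout.inr g f ≫ FGModuleCat.ofHom t, by
    rw [← pushout.condition_assoc, ht', Category.comp_id]⟩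

theorem enoughInjectives (R : Type v) [CommRing R] [IsArtinianRing R] {A : Type u}
    [Ring A] [Algebra R A] [Module.Finite R A]
    [IsNoetherianRing A] : EnoughInjectives (FGModuleCat.{u} A) where
  presentation M := by
    obtain ⟨E, j, hE, hj⟩ := exists_injective_mono R M
    exact ⟨⟨E, hE, j, hj⟩⟩

/-- There is a finitely generated injective module `E`, namely one that contains `A` modulo its
radical, such that every finitely generated module embeds in a power of `E`. -/
theorem exists_injective_cogenerator (R : Type v) [CommRing R] [IsArtinianRing R] {A : Type u}
    [Ring A] [Algebra R A] [Module.Finite R A]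
    [IsNoetherianRing A] :
    ∃ E : FGModuleCat.{u} A, Injective E ∧ ∀ X : FGModuleCat.{u} A,
      ∃ (k : ℕ) (f : X ⟶ ⨁ fun _ : Fin k => E), Mono f := by
  have : IsArtinianRing A := isArtinian_of_tower R inferInstance
  obtain ⟨E, j, hE, hj⟩ := exists_injective_mono R (FGModuleCat.of A (A ⧸ Ring.jacobson A))
  rw [mono_iff_injective] at hj
  refine ⟨E, hE, fun X => ?_⟩
  let Xs : Submodule A X :=
    { carrier := {x | ∀ a ∈ Ring.jacobson A, a • x = 0}
      add_mem' := fun hx hy a ha => by rw [smul_add, hx a ha, hy a ha, add_zero]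
      zero_mem' := fun a _ => smul_zero a
      smul_mem' := fun c x hx a ha => by
        rw [smul_smul]
        exact hx _ (Ideal.mul_mem_right _ _ ha) }
  obtain ⟨k, x, hx⟩ := Submodule.fg_iff_exists_fin_generating_family.mp
    (IsNoetherian.noetherian (⊤ : Submodule A Xs))
  have hXs : IsSemisimpleModule A Xs := isSemisimpleModule_of_jacobson_smul fun a ha y =>
    Subtype.ext (y.2 a ha)
  let q : (Fin k → A ⧸ Ring.jacobson A) →ₗ[A] Xs :=
    ∑ i, ((Ring.jacobson A).liftQ (LinearMap.toSpanSingleton A Xs (x i))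
      (fun a ha => Subtype.ext ((x i).2 a ha))) ∘ₗ LinearMap.proj i
  have hq : Function.Surjective q := by
    intro y
    have hy : y ∈ Submodule.span A (Set.range x) := by rw [hx]; trivial
    obtain ⟨c, rfl⟩ := (Submodule.mem_span_range_iff_exists_fun A).mp hy
    refine ⟨fun i => Submodule.Quotient.mk (c i), ?_⟩
    rw [LinearMap.sum_apply]
    rfl
  have hB : IsSemisimpleModule A (Fin k → A ⧸ Ring.jacobson A) :=
    isSemisimpleModule_of_jacobson_smul fun a ha y => funext fun i => by
      obtain ⟨c, hc⟩ := Submodule.Quotient.mk_surjective _ (y i)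
      rw [Pi.smul_apply, ← hc]
      exact (Submodule.Quotient.mk_eq_zero _).mpr (Ideal.mul_mem_right c _ ha)
  obtain ⟨σ, hσ⟩ := IsSemisimpleModule.lifting_property q hq LinearMap.id
  let ι : FGModuleCat.of A Xs ⟶ X := FGModuleCat.ofHom Xs.subtype
  have : Mono ι := (mono_iff_injective _).mpr Subtype.val_injective
  let h (i : Fin k) : X ⟶ E :=
    Injective.factorThru (FGModuleCat.ofHom (LinearMap.proj i ∘ₗ σ) ≫ j) ι
  have hh (i : Fin k) (y : Xs) : (h i).hom.hom y = j.hom.hom (σ y i) :=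
    congrArg (fun f => f.hom.hom y) (Injective.comp_factorThru _ _ : ι ≫ h i = _)
  refine ⟨k, biproduct.lift h, (mono_iff_injective _).mpr ?_⟩
  rw [← LinearMap.ker_eq_bot]
  by_contra hne
  obtain ⟨y, hy, hy0, hyJ⟩ := exists_mem_jacobson_smul_eq_zero hne
  have hi (i : Fin k) : (h i).hom.hom y = 0 := by
    have : biproduct.lift h ≫ biproduct.π _ i = h i := biproduct.lift_π _ _
    rw [← this]
    exact (congrArg (biproduct.π (fun _ : Fin k => E) i).hom.hom hy).trans (map_zero _)
  have hσy : σ ⟨y, hyJ⟩ = 0 := funext fun i => hj <| by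
    rw [← hh i ⟨y, hyJ⟩]
    exact (hi i).trans (map_zero _).symm
  have := LinearMap.congr_fun hσ ⟨y, hyJ⟩
  rw [LinearMap.comp_apply, hσy, map_zero] at this
  exact hy0 (congrArg Subtype.val this.symm)

end Injectives

/-! ### Representation-finite algebras and torsionless modules -/

section RepresentationFinite

lemma IsRepresentationFinite.of_ringEquiv {A B : Type u} [Ring A] [Ring B] (e : A ≃+* B)
    (h : IsRepresentationFinite A) : IsRepresentationFinite B := by
  obtain ⟨k, F, hF⟩ := h
  have := RingHomInvPair.of_ringEquiv e
  have := RingHomInvPair.of_ringEquiv e.symm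
  have : RingHomInvPair (e.symm : B →+* A) (e : A →+* B) := RingHomInvPair.of_ringEquiv e.symm
  let _ (i : Fin k) : Module B (F i) := Module.compHom (F i) (e.symm : B →+* A)
  have hfin (i : Fin k) : Module.Finite B (F i) :=
    Module.Finite.of_surjective (σ := (e : A →+* B))
      { toFun := fun x : F i => x
        map_add' := fun _ _ => rfl
        map_smul' := fun a x => by
          change a • x = e.symm (e a) • x
          rw [e.symm_apply_apply] } Function.surjective_id
  refine ⟨k, fun i => FGModuleCat.of B (F i), fun M hM hind => ?_⟩
  let _ : Module A M := Module.compHom M (e : A →+* B)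
  let ε : M ≃ₛₗ[(e : A →+* B)] M :=
    { AddEquiv.refl M with map_smul' := fun a x => rfl }
  have : Module.Finite A M :=
    Module.Finite.of_surjective (ε.symm : M →ₛₗ[(e.symm : B →+* A)] M) ε.symm.surjective
  obtain ⟨i, ⟨f⟩⟩ := hF (FGModuleCat.of A M) hM fun N N' hN => by
    let o := Submodule.orderIsoMapComap ε
    refine (hind (o N) (o N') (o.isCompl hN)).imp (fun h => ?_) fun h => ?_
    · exact (map_eq_bot_iff o).mp h
    · exact (map_eq_bot_iff o).mp h
  exact ⟨i, ⟨{ f.toAddEquiv with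
    map_smul' := fun b x => by
      change f (b • x) = e.symm b • f x
      have h : b • x = e.symm b • x := by
        change _ = e (e.symm b) • x
        rw [e.apply_symm_apply]
      rw [h]
      exact f.map_smul _ _ }⟩⟩

attribute [local instance] Abelian.hasFiniteBiproducts

variable {A : Type u} [Ring A] [IsNoetherianRing A]

lemma addClosure_of_isCompl {U : ObjectProperty (FGModuleCat.{u} A)} {M : FGModuleCat.{u} A}
    {N N' : Submodule A M} (h : IsCompl N N') (hN : addClosure U (FGModuleCat.of A N))
    (hN' : addClosure U (FGModuleCat.of A N')) : addClosure U M := by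
  refine addClosure_of_retract ?_ (addClosure_biprod hN hN')
  exact
    { i := biprod.lift (FGModuleCat.ofHom (N.projectionOnto N' h))
        (FGModuleCat.ofHom (N'.projectionOnto N h.symm))
      r := biprod.desc (FGModuleCat.ofHom N.subtype) (FGModuleCat.ofHom N'.subtype)
      retract := by
        rw [biprod.lift_desc]
        refine FGModuleCat.hom_ext (LinearMap.ext fun x => ?_)
        exact Submodule.projection_add_projection_eq_self h x }

/-- Splitting off direct summands ends by induction on the length, so every finitely generated
module is a finite direct sum of indecomposable ones. -/
lemma IsRepresentationFinite.exists_addClosure [IsArtinianRing A]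
    (h : IsRepresentationFinite A) :
    ∃ T : FGModuleCat.{u} A, ∀ M, addClosure (ObjectProperty.singleton T) M := by
  obtain ⟨k, F, hF⟩ := h
  refine ⟨⨁ F, fun M => ?_⟩
  induction hl : Module.length A M using WellFoundedLT.induction generalizing M with
  | ind l ih =>
    obtain hM | hM := subsingleton_or_nontrivial M
    · refine addClosure_of_isZero ((IsZero.iff_id_eq_zero _).mpr ?_)
      exact FGModuleCat.hom_ext (LinearMap.ext fun x => Subsingleton.elim _ _)
    by_cases hind : ∀ N N' : Submodule A M, IsCompl N N' → N = ⊥ ∨ N' = ⊥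
    · obtain ⟨i, ⟨f⟩⟩ := hF M hM hind
      refine addClosure_of_retract (Y := ⨁ F) ?_ (addClosure_self _)
      exact (Retract.ofIso (LinearEquiv.toFGModuleCatIso f)).trans
        ⟨biproduct.ι F i, biproduct.π F i, by simp⟩
    · push Not at hind
      obtain ⟨N, N', hN, h1, h2⟩ := hind
      have hlt {K K' : Submodule A M} (hK : IsCompl K K') (hne : K' ≠ ⊥) :
          Module.length A K < l := by
        rw [← hl]
        exact Submodule.length_lt fun ht => hne (by rw [ht] at hK; exact eq_bot_of_top_isCompl hK)
      exact addClosure_of_isCompl hN (ih _ (hlt hN h2) (FGModuleCat.of A N) rfl)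
        (ih _ (hlt hN.symm h1) (FGModuleCat.of A N') rfl)

end RepresentationFinite

section Torsionless

/-- A finitely generated module is torsionless if it embeds in a finitely generated free module. -/
def IsTorsionless {A : Type u} [Ring A] (Y : FGModuleCat.{u} A) : Prop :=
  ∃ (k : ℕ) (f : Y →ₗ[A] (Fin k → A)), Function.Injective f

lemma IsTorsionless.of_injective {A : Type u} [Ring A] {X Y : FGModuleCat.{u} A}
    (hY : IsTorsionless Y) (f : X →ₗ[A] Y) (hf : Function.Injective f) : IsTorsionless X := by
  obtain ⟨k, g, hg⟩ := hY
  exact ⟨k, g ∘ₗ f, hg.comp hf⟩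

lemma isTorsionless_of_projective {A : Type u} [Ring A] [IsNoetherianRing A]
    (P : FGModuleCat.{u} A) [Projective P] : IsTorsionless P := by
  obtain ⟨k, ⟨r⟩⟩ := exists_retract_of_projective P
  exact ⟨k, r.i.hom.hom, (mono_iff_injective r.i).mp inferInstance⟩

variable {R : Type v} [CommRing R] {E : Type u} [Ring E] [Algebra R E] {A C : Subalgebra R E}

/-- The elements of `rad P` can be multiplied by elements of the larger algebra `C`, in a way that
is compatible with all linear forms on `P`. -/
lemma IsLeftIdealizedExtension.exists_mul (h : IsLeftIdealizedExtension A C) {P : Type*}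
    [AddCommGroup P] [Module A P] {y : P} (hy : y ∈ Ring.jacobson A • (⊤ : Submodule A P)) {c : E}
    (hc : c ∈ C) : ∃ y' : P, ∀ φ : P →ₗ[A] A, (φ y' : E) = c * φ y := by
  induction hy using Submodule.smul_induction_on' with
  | smul a ha x hx =>
    obtain ⟨a', -, ha'⟩ := h.2 c hc a ha
    refine ⟨a' • x, fun φ => ?_⟩
    rw [map_smul, map_smul, smul_eq_mul, smul_eq_mul, Subalgebra.coe_mul, Subalgebra.coe_mul, ha',
      mul_assoc]
  | add x _ y _ hx hy =>
    obtain ⟨x', hx'⟩ := hx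
    obtain ⟨y', hy'⟩ := hy
    refine ⟨x' + y', fun φ => ?_⟩
    rw [map_add, map_add, Subalgebra.coe_add, Subalgebra.coe_add, hx', hy', mul_add]

variable [IsArtinianRing R] [Module.Finite R E]

instance isArtinianRing_subalgebra (A : Subalgebra R E) : IsArtinianRing A :=
  isArtinian_of_tower R (inferInstanceAs (IsArtinian R (Subalgebra.toSubmodule A)))

/-- A linear equivalence as an isomorphism in `FGModuleCat`. Unlike with
`LinearEquiv.toFGModuleCatIso`, the objects are given rather than inferred. -/
def isoOfLinearEquiv {A : Type u} [Ring A] {X Y : FGModuleCat.{u} A} (f : X ≃ₗ[A] Y) : X ≅ Y :=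
  LinearEquiv.toFGModuleCatIso f

/-- An additive equivalence that is compatible with the actions identifies a module with the
restriction of another one. -/
noncomputable def restrictFGIso (h : A ≤ C) {N : FGModuleCat.{u} A} {M : FGModuleCat.{u} C}
    (e : N ≃+ M) (he : ∀ (a : A) (x : N), e (a • x) = Subalgebra.inclusion h a • e x) :
    N ≅ (restrictFG h).obj M :=
  let f : N ≃ₗ[A] (restrictFG h).obj M :=
    { e.trans (restrictFGEquiv h M).symm with map_smul' := he }
  isoOfLinearEquiv (X := N) (Y := (restrictFG h).obj M) f

/-- The first syzygy of a torsionless module `Y` over `A` is the restriction of a torsionless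
module over a left idealized extension `C`. Inside a free module over `C` that contains a free
module into which the projective cover `P` embeds, the kernel of `P ⟶ Y` lies in `rad P` and is
stable under `C`, because `P` and `Y` are both separated by linear forms. -/
theorem IsLeftIdealizedExtension.exists_torsionless_iso_ker (h : IsLeftIdealizedExtension A C)
    {P Y : FGModuleCat.{u} A} (hY : IsTorsionless Y) {p : P ⟶ Y} (hp : IsProjectiveCover p) :
    ∃ K : FGModuleCat.{u} C, IsTorsionless K ∧
      Nonempty ((restrictFG h.1).obj K ≅ FGModuleCat.of A (LinearMap.ker p.hom.hom)) := by
  have := hp.projective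
  obtain ⟨l, α, hα⟩ := isTorsionless_of_projective P
  obtain ⟨k, β, hβ⟩ := hY
  let D : Submodule C (Fin l → C) :=
    { carrier := {z | ∃ y ∈ LinearMap.ker p.hom.hom, ∀ i, (z i : E) = α y i}
      add_mem' := by
        rintro z z' ⟨y, hy, hz⟩ ⟨y', hy', hz'⟩
        refine ⟨y + y', Submodule.add_mem _ hy hy', fun i => ?_⟩
        rw [map_add, Pi.add_apply, Pi.add_apply, Subalgebra.coe_add, Subalgebra.coe_add, hz, hz']
      zero_mem' := ⟨0, Submodule.zero_mem _, fun i => by rw [map_zero]; rfl⟩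
      smul_mem' := by
        rintro c z ⟨y, hy, hz⟩
        obtain ⟨y', hy'⟩ := h.exists_mul (hp.ker_le hy) c.2
        refine ⟨y', hβ ?_, fun i => ?_⟩
        · rw [map_zero]
          refine funext fun j => Subtype.ext ?_
          refine (hy' (LinearMap.proj j ∘ₗ β ∘ₗ p.hom.hom)).trans ?_
          have : (LinearMap.proj j ∘ₗ β ∘ₗ p.hom.hom) y = 0 := by
            rw [LinearMap.comp_apply, LinearMap.comp_apply, LinearMap.mem_ker.mp hy, map_zero,
              map_zero]
          rw [this]
          exact mul_zero _
        · rw [Pi.smul_apply, smul_eq_mul, Subalgebra.coe_mul, hz]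
          exact (hy' (LinearMap.proj i ∘ₗ α)).symm }
  let g : LinearMap.ker p.hom.hom →+ D :=
    { toFun := fun y => ⟨fun i => Subalgebra.inclusion h.1 (α y i), y, y.2, fun i => rfl⟩
      map_zero' := Subtype.ext (funext fun i => Subtype.ext
        (congrArg (fun z : Fin l → A => (z i : E)) (map_zero α)))
      map_add' := fun x y => Subtype.ext (funext fun i => Subtype.ext
        (congrArg (fun z : Fin l → A => (z i : E)) (map_add α x.1 y.1))) }
  have hg : Function.Bijective g := by
    refine ⟨fun x y hxy => Subtype.ext (hα (funext fun i => ?_)), fun ⟨z, y, hy, hz⟩ =>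
      ⟨⟨y, hy⟩, Subtype.ext (funext fun i => Subtype.ext (hz i).symm)⟩⟩
    exact Subalgebra.inclusion_injective h.1 (congrFun (congrArg Subtype.val hxy) i)
  refine ⟨FGModuleCat.of C D, ⟨l, D.subtype, Subtype.val_injective⟩, ⟨(restrictFGIso h.1
    (N := FGModuleCat.of A (LinearMap.ker p.hom.hom)) (M := FGModuleCat.of C D)
    (AddEquiv.ofBijective g hg) fun a x => ?_).symm⟩⟩
  exact Subtype.ext (funext fun i => Subtype.ext
    (congrArg (fun z : Fin l → A => (z i : E)) (map_smul α a x.1)))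

/-- Restricting in two steps is the same as restricting in one. -/
noncomputable def restrictFGCompIso {B : Subalgebra R E} (h : A ≤ B) (h' : B ≤ C)
    (M : FGModuleCat.{u} C) :
    (restrictFG h).obj ((restrictFG h').obj M) ≅ (restrictFG (h.trans h')).obj M :=
  restrictFGIso (h.trans h') ((restrictFGEquiv h _).trans (restrictFGEquiv h' M)) fun _ _ => rfl

/-- Restricting along the identity does nothing. -/
noncomputable def restrictFGSelfIso (h : A ≤ A) (M : FGModuleCat.{u} A) :
    M ≅ (restrictFG h).obj M :=
  restrictFGIso h (AddEquiv.refl M) fun _ _ => rfl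

end Torsionless

/-! ### Chains of left idealized extensions -/

section Chain

lemma chain_le {α : Type*} [Preorder α] {Λ : ℕ → α} {m : ℕ} (hΛ : ∀ i < m, Λ i ≤ Λ (i + 1)) {i : ℕ}
    (hi : i ≤ m) : Λ 0 ≤ Λ i := by
  induction i with
  | zero => exact le_rfl
  | succ i ih => exact (ih (by omega)).trans (hΛ i (by omega))

attribute [local instance] Abelian.hasFiniteBiproducts

variable {R : Type v} [CommRing R] [IsArtinianRing R] {E : Type u} [Ring E] [Algebra R E]
  [Module.Finite R E] {m : ℕ} {Λ : ℕ → Subalgebra R E}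

/-- A torsionless module over the `i`-th algebra of the chain has over `Λ 0` a resolution of
length `j = m - i`: take projective covers, and pass to the next algebra with every syzygy. After
`j` steps the syzygy is the restriction of a module over the last algebra. -/
lemma hasResolution_of_isTorsionless {V : FGModuleCat.{u} (Λ 0)}
    (hΛ : ∀ i < m, IsLeftIdealizedExtension (Λ i) (Λ (i + 1)))
    (hV : ∀ i < m, ∀ h : Λ 0 ≤ Λ i, addClosure (ObjectProperty.singleton V)
      ((restrictFG h).obj (FGModuleCat.of (Λ i) (Λ i))))
    (hV' : ∀ (h : Λ 0 ≤ Λ m) (Y : FGModuleCat.{u} (Λ m)),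
      addClosure (ObjectProperty.singleton V) ((restrictFG h).obj Y))
    (j i : ℕ) (hij : i + j = m) (h : Λ 0 ≤ Λ i) (Y : FGModuleCat.{u} (Λ i))
    (hY : IsTorsionless Y) :
    HasResolution (addClosure (ObjectProperty.singleton V)) j ((restrictFG h).obj Y) := by
  induction j generalizing i with
  | zero =>
    obtain rfl : i = m := hij
    exact ⟨_, hV' h Y, ⟨Iso.refl _⟩⟩
  | succ j ih =>
    obtain ⟨P, p, hp⟩ := exists_isProjectiveCover Y
    have hi := hΛ i (by omega)
    obtain ⟨K, hK, ⟨e⟩⟩ := hi.exists_torsionless_iso_ker hY hp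
    have := hp.projective
    have := hp.epi
    have hS := restrictFG_shortExact h
      (kernelShortComplex_shortExact p ((epi_iff_surjective p).mp inferInstance))
    refine HasResolution.succ hS ?_ ?_
    · refine addClosure_functor (restrictFG h) (fun X hX => ?_) (addClosure_of_projective P)
      rw [ObjectProperty.singleton_iff] at hX
      subst hX
      exact hV i (by omega) h
    · exact (ih (i + 1) (by omega) (h.trans hi.1) K hK).of_iso
        ((restrictFGCompIso h hi.1 K).symm ≪≫ (restrictFG h).mapIso e)

/-- One module over `Λ 0` generates all the modules needed for the resolutions: the direct sum of
the algebras `Λ i` with `i < m`, and of the indecomposable modules over the last algebra. -/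
lemma exists_generator (hΛ : ∀ i < m, Λ i ≤ Λ (i + 1)) (hfin : IsRepresentationFinite (Λ m)) :
    ∃ V : FGModuleCat.{u} (Λ 0),
      (∀ i < m, ∀ h : Λ 0 ≤ Λ i, addClosure (ObjectProperty.singleton V)
        ((restrictFG h).obj (FGModuleCat.of (Λ i) (Λ i)))) ∧
      ∀ (h : Λ 0 ≤ Λ m) (Y : FGModuleCat.{u} (Λ m)),
        addClosure (ObjectProperty.singleton V) ((restrictFG h).obj Y) := by
  obtain ⟨T, hT⟩ := hfin.exists_addClosure
  let F (i : Fin m) : FGModuleCat.{u} (Λ 0) :=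
    (restrictFG (chain_le hΛ i.2.le)).obj (FGModuleCat.of (Λ i) (Λ i))
  refine ⟨(restrictFG (chain_le hΛ le_rfl)).obj T ⊞ ⨁ F, fun i hi h => ?_, fun h Y => ?_⟩
  · refine addClosure_singleton_le_right _ _ _ (addClosure_of_retract (Y := ⨁ F) ?_
      (addClosure_self _))
    exact ⟨biproduct.ι F ⟨i, hi⟩, biproduct.π F ⟨i, hi⟩, biproduct.ι_π_self _ _⟩
  · refine addClosure_singleton_le_left _ _ _
      (addClosure_functor (restrictFG h) (fun X hX => ?_) (hT Y))
    rw [ObjectProperty.singleton_iff] at hX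
    subst hX
    exact addClosure_self _

end Chain

end ArtinAlg

theorem theorem4p4 {R : Type v} [CommRing R] [IsArtinianRing R]
    {Γ : Type u} [Ring Γ] [Algebra R Γ] [Module.Finite R Γ]
    (m : ℕ) (hm : 1 ≤ m) (Λ : ℕ → Subalgebra R Γ) (hΓ : Λ m = ⊤)
    (hΛ : ∀ i < m, ArtinAlg.IsLeftIdealizedExtension (Λ i) (Λ (i + 1)))
    (hfin : ArtinAlg.IsRepresentationFinite Γ)
    [HasDerivedCategory.{w} (FGModuleCat.{u} (Λ 0))] :
    ArtinAlg.IsIgusaTodorov (Λ 0) (m - 1) 2 ∧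
      ArtinAlg.triDim (ArtinAlg.BoundedDerivedCategory (FGModuleCat.{u} (Λ 0))) ≤ 2 * m + 1 ∧
      ArtinAlg.extDim (FGModuleCat.{u} (Λ 0)) ≤ m + 1 := by
  open ArtinAlg in
  have hfin' : IsRepresentationFinite (Λ m) := by
    rw [hΓ]
    exact hfin.of_ringEquiv Subalgebra.topEquiv.symm.toRingEquiv
  obtain ⟨V, hV, hV'⟩ := exists_generator (fun i hi => (hΛ i hi).1) hfin'
  have key := hasResolution_of_isTorsionless hΛ hV hV'
  have hsub (Y P : FGModuleCat.{u} (Λ 0)) (f : Y ⟶ P) [Mono f] [Projective P] :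
      HasResolution (addClosure (ObjectProperty.singleton V)) m Y :=
    (key m 0 (by omega) le_rfl Y ((isTorsionless_of_projective P).of_injective f.hom.hom
      ((ArtinAlg.mono_iff_injective f).mp inferInstance))).of_iso (restrictFGSelfIso le_rfl Y).symm
  -- here `1 ≤ m` is needed for `Λ 0` to be a summand of `V`
  have hproj (P : FGModuleCat.{u} (Λ 0)) [Projective P] :
      addClosure (ObjectProperty.singleton V) P := by
    refine addClosure_le (fun X hX => ?_) _ (addClosure_of_projective P)
    rw [ObjectProperty.singleton_iff] at hX
    subst hX
    exact addClosure_of_retract (Retract.ofIso (restrictFGSelfIso le_rfl _))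
      (hV 0 (by omega) le_rfl)
  -- `V` works for the first two statements; the generator for the third one is larger
  refine ⟨⟨V, fun M => ?_⟩, triDim_le_of_hasResolution hsub, ?_⟩
  · obtain ⟨P₀, p₀, hp₀⟩ := exists_isProjectiveCover M
    have := hp₀.projective
    have := hp₀.epi
    obtain ⟨P₁, p₁, hp₁⟩ :=
      exists_isProjectiveCover (FGModuleCat.of (Λ 0) (LinearMap.ker p₀.hom.hom))
    have := hp₁.epi
    refine ⟨FGModuleCat.of (Λ 0) (LinearMap.ker p₁.hom.hom), ?_, ?_⟩
    · exact ⟨_, _, _, p₁, _, ⟨_, _, _, p₀, _, ⟨Iso.refl _⟩, hp₀, kernelShortComplex_shortExact p₀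
        ((ArtinAlg.epi_iff_surjective p₀).mp inferInstance)⟩, hp₁, kernelShortComplex_shortExact p₁
        ((ArtinAlg.epi_iff_surjective p₁).mp inferInstance)⟩
    -- the second syzygy lives over `Λ 1`, which exists because `1 ≤ m`
    · have h01 := hΛ 0 (by omega)
      obtain ⟨K, hK, ⟨e⟩⟩ := h01.exists_torsionless_iso_ker
        ((isTorsionless_of_projective P₀).of_injective (LinearMap.ker p₀.hom.hom).subtype
          Subtype.val_injective) hp₁
      exact (key (m - 1) 1 (by omega) h01.1 K hK).of_iso e
  · have := enoughInjectives R (A := Λ 0)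
    obtain ⟨I, hI, hI'⟩ := exists_injective_cogenerator R (A := Λ 0)
    refine (extDim_le_of_hasResolution (n := m + 1) (V := V) hI' fun X => ?_).trans (by simp)
    have hS := kernelShortComplex_shortExact (Projective.π X)
      ((ArtinAlg.epi_iff_surjective _).mp inferInstance)
    have hmono := hS.mono_f
    exact HasResolution.succ hS (hproj (Projective.over X)) (hsub _ (Projective.over X) (kernelShortComplex (Projective.π X)).f)
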